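/- Let $\mathbb{F}$ be a field and let $n\ge 0$ denote a degree. **Horizontal chord diagrams.** For $N\ge 1$ let $\mathcal{A}^{\mathrm{pb}}_{N,n}$ be the $\mathbb{F}$-vector space spanned by the words of length $n$ in the letters $t_{ij}=t_{ji}$ ($i\neq j$ in $\{1,\dots,N\}$; the letter $t_{ij}$ is a chord between the strands $i$ and $j$, and a word is a horizontal chord diagram with $N$ strands and $n$ chords), modulo the degree $n$ part of the two-sided ideal generated by $$(2\mathrm{T})\;\; [t_{ij},t_{kl}],\qquad (4\mathrm{T})\;\; [t_{ik}+t_{jk},\,t_{ij}]\qquad (i,j,k,l \text{ pairwise distinct}).$$ Put $\mathcal{A}^{\mathrm{pb}}_n:=\bigoplus_{N\ge 1}\mathcal{A}^{\mathrm{pb}}_{N,n}$ (any number of strands). **Round chord diagrams.** A round chord diagram of degree $n$ is an oriented circle with $2n$ marked points joined in pairs by $n$ chords, up to cyclic permutation along the circle. Let $\mathcal{A}^{\mathrm{c}}_n$ be the $\mathbb{F}$-span of these, modulo the round 4T relations: given a chord with ends $x,y$ and a second chord one of whose ends is fixed elsewhere, while its other end is put directly before or directly after $x$ or $y$ (all other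 chords being fixed), $$[\text{before }x]+[\text{before }y]=[\text{after }x]+[\text{after }y].$$ **Jacobi diagrams.** A Jacobi diagram of degree $n$ is a connected trivalent finite graph (multiple edges and loops allowed) with $2n$ vertices and a distinguished oriented circle, together with a cyclic orientation of the three half-edges at each internal vertex (a vertex not on the circle), up to isomorphism. For $n=0$ this is the circle without vertices. Let $\mathcal{A}^{\mathrm{t}}_n$ be the $\mathbb{F}$-span of these, modulo the STU relations $[S]=[T]-[U]$: in $S$ an internal vertex, with half-edges $(\ell,a,b)$ in cyclic orientation, is joined by $\ell$ to a point of the circle; $T$ and $U$ arise by deleting this vertex and this edge and attaching the ends of the other two edges to two consecutive points of the circle in place of the original one, in the order $b,a$ along the circle for $T$ and in the order $a,b$ for $U$. **Weight systems.** The spaces $\mathcal{W}^{\mathrm{pb}}$, $\mathcal{W}^{\mathrm{c}}$, $\mathcal{W}^{\mathrm{t}}$ of weight systems are the graded linear duals $\bigoplus_n(\mathcal{A}_n)^*$ of $\mathcal{A}^{\mathrm{pb}}$, $\mathcal{A}^{\mathrm{c}}$, $\mathcal{A}^{\mathrm{t}}$. **Theorem.** Closing a horizontal chord diagram with $N$ strands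 along the cyclic permutation of the strands (the end of each strand is joined to the start of the next one, the end of the last strand to the start of the first), and regarding a round chord diagram as a Jacobi diagram without internal vertices, induce well-defined graded linear maps $$\mathcal{A}^{\mathrm{pb}}_{N}\xrightarrow{\ \mathrm{close}_N\ }\mathcal{A}^{\mathrm{c}}\xrightarrow{\ i\ }\mathcal{A}^{\mathrm{t}}\qquad (N\ge1).$$ Moreover: 1. $i$ is an isomorphism in each degree, and the dual linear map $i^*:\mathcal{W}^{\mathrm{t}}\to\mathcal{W}^{\mathrm{c}}$ from weight systems on Jacobi diagrams to weight systems on round chord diagrams is a bijection. 2. The linear map $\mathrm{close}^*:\mathcal{W}^{\mathrm{c}}\to\mathcal{W}^{\mathrm{pb}}$ dual to $(\mathrm{close}_N)_{N\ge1}$, from weight systems on round chord diagrams to weight systems on horizontal chord diagrams (with any number of strands), is an injection. For a fixed number $N$ of strands, $\mathrm{close}_N^*:(\mathcal{A}^{\mathrm{c}}_n)^*\to(\mathcal{A}^{\mathrm{pb}}_{N,n})^*$ is injective in every degree $n<N$. -/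

import Mathlib

open scoped DirectSum

namespace ChordDiagrams

/-! ### Horizontal chord diagrams -/

/-- A chord between two distinct strands out of `N`; it is undirected, so it is recorded
by its two strands in increasing order. -/
abbrev Chord (N : ℕ) : Type := {p : Fin N × Fin N // p.1 < p.2}

/-- The chord `t_{ij} = t_{ji}` between two distinct strands. -/
def Chord.between {N : ℕ} (i j : Fin N) (h : i ≠ j) : Chord N :=
  ⟨(min i j, max i j), min_lt_max.2 h⟩

/-- A horizontal chord diagram with `N` strands and `n` chords: the word of its chords,
listed in the order in which they are met along the orientation of the strands. -/
abbrev HorizontalDiagram (N n : ℕ) : Type := List.Vector (Chord N) n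

/-- The 2T relators `u (t_{ij} t_{kl} - t_{kl} t_{ij}) v` in degree `n`, for pairwise distinct
strands `i, j, k, l` and words `u, v`. -/
def twoTermRelators (F : Type*) [Field F] (N n : ℕ) : Set (HorizontalDiagram N n →₀ F) :=
  {r | ∃ (u v : List (Chord N)) (i j k l : Fin N) (hij : i ≠ j) (hkl : k ≠ l)
      (A B : HorizontalDiagram N n),
      i ≠ k ∧ i ≠ l ∧ j ≠ k ∧ j ≠ l ∧
      A.toList = u ++ [Chord.between i j hij, Chord.between k l hkl] ++ v ∧
      B.toList = u ++ [Chord.between k l hkl, Chord.between i j hij] ++ v ∧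
      r = Finsupp.single A 1 - Finsupp.single B 1}

/-- The 4T relators `u ((t_{ik} + t_{jk}) t_{ij} - t_{ij} (t_{ik} + t_{jk})) v` in degree `n`,
for pairwise distinct strands `i, j, k` and words `u, v`. -/
def horizontalFourTermRelators (F : Type*) [Field F] (N n : ℕ) :
    Set (HorizontalDiagram N n →₀ F) :=
  {r | ∃ (u v : List (Chord N)) (i j k : Fin N) (hij : i ≠ j) (hik : i ≠ k) (hjk : j ≠ k)
      (A B C D : HorizontalDiagram N n),
      A.toList = u ++ [Chord.between i k hik, Chord.between i j hij] ++ v ∧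
      B.toList = u ++ [Chord.between j k hjk, Chord.between i j hij] ++ v ∧
      C.toList = u ++ [Chord.between i j hij, Chord.between i k hik] ++ v ∧
      D.toList = u ++ [Chord.between i j hij, Chord.between j k hjk] ++ v ∧
      r = Finsupp.single A 1 + Finsupp.single B 1
        - (Finsupp.single C 1 + Finsupp.single D 1)}

/-- The degree `n` part of the space of horizontal chord diagrams with `N` strands,
modulo the 2T and 4T relations. -/
abbrev HorizontalSpace (F : Type*) [Field F] (N n : ℕ) : Type _ :=
  (HorizontalDiagram N n →₀ F) ⧸
    Submodule.span F (twoTermRelators F N n ∪ horizontalFourTermRelators F N n)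

/-- The class of a horizontal chord diagram modulo 2T and 4T. -/
noncomputable def HorizontalDiagram.toSpace (F : Type*) [Field F] {N n : ℕ}
    (D : HorizontalDiagram N n) : HorizontalSpace F N n :=
  Submodule.Quotient.mk (Finsupp.single D 1)

/-! ### Round chord diagrams -/

/-- A round chord diagram with `n` chords and with a base point: the vertices on the circle are
`0, …, 2n-1`, in this order along the orientation, and the chords join them in pairs. -/
structure BasedRound (n : ℕ) where
  /-- the other end of the chord at a given vertex -/
  mate : Equiv.Perm (Fin (2 * n))
  mate_mate : ∀ x, mate (mate x) = x
  mate_ne : ∀ x, mate x ≠ x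

/-- Two based diagrams are equivalent if they differ by a cyclic permutation along the circle. -/
def BasedRound.setoid (n : ℕ) : Setoid (BasedRound n) where
  r D E := ∃ c : ℤ, ∀ x, ((finRotate (2 * n)) ^ c) (D.mate x) =
    E.mate (((finRotate (2 * n)) ^ c) x)
  iseqv :=
    { refl := fun D => ⟨0, fun x => by simp⟩
      symm := by
        rintro D E ⟨c, hc⟩
        refine ⟨-c, fun x => ?_⟩
        have h := hc (((finRotate (2 * n)) ^ (-c)) x)
        have e : ∀ y, ((finRotate (2 * n)) ^ c) (((finRotate (2 * n)) ^ (-c)) y) = y := by simp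
        have e' : ∀ y, ((finRotate (2 * n)) ^ (-c)) (((finRotate (2 * n)) ^ c) y) = y := by simp
        rw [e] at h
        rw [← h, e']
      trans := by
        rintro D E G ⟨c, hc⟩ ⟨d, hd⟩
        refine ⟨d + c, fun x => ?_⟩
        rw [zpow_add, Equiv.Perm.mul_apply, Equiv.Perm.mul_apply, hc, hd] }

/-- Round chord diagrams with `n` chords. -/
def RoundDiagram (n : ℕ) : Type := Quotient (BasedRound.setoid n)

/-- The round chord diagram underlying a based one. -/
def BasedRound.toRound {n : ℕ} (D : BasedRound n) : RoundDiagram n :=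
  Quotient.mk (BasedRound.setoid n) D

/-- `IsInsertion τ z p D`: here `τ` pairs up all of the `2k+1` vertices of a circle except `z`,
and `D` arises from it by inserting a new vertex, which gets position `p`, and
joining it to `z` by a chord. -/
def IsInsertion {k : ℕ} (τ : Equiv.Perm (Fin (2 * k + 1))) (z : Fin (2 * k + 1))
    (p : Fin (2 * k + 1 + 1)) (D : BasedRound (k + 1)) : Prop :=
  D.mate p = p.succAbove z ∧ ∀ y, y ≠ z → D.mate (p.succAbove y) = p.succAbove (τ y)

/-- The round 4T relators. A chord joins `x` to `τ x`, and one end of a second chord is fixed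
at a vertex `z`. The other end of the second chord is put just before or just after
`x`, or just before or just after `τ x`; the relator is
`[before x] + [before τ x] - [after x] - [after τ x]`. -/
def roundFourTermRelators (F : Type*) [Field F] : (n : ℕ) → Set (RoundDiagram n →₀ F)
  | 0 => ∅
  | k + 1 =>
    {r | ∃ (τ : Equiv.Perm (Fin (2 * k + 1))) (z x : Fin (2 * k + 1))
        (A B C D : BasedRound (k + 1)),
        (∀ y, τ (τ y) = y) ∧ (∀ y, τ y = y ↔ y = z) ∧ x ≠ z ∧
        IsInsertion τ z x.castSucc A ∧ IsInsertion τ z (τ x).castSucc B ∧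
        IsInsertion τ z x.succ C ∧ IsInsertion τ z (τ x).succ D ∧
        r = Finsupp.single A.toRound 1 + Finsupp.single B.toRound 1
          - (Finsupp.single C.toRound 1 + Finsupp.single D.toRound 1)}

/-- The degree `n` part of the space of round chord diagrams modulo 4T. -/
abbrev RoundSpace (F : Type*) [Field F] (n : ℕ) : Type _ :=
  (RoundDiagram n →₀ F) ⧸ Submodule.span F (roundFourTermRelators F n)

/-- The class of a round chord diagram modulo 4T. -/
noncomputable def RoundDiagram.toSpace (F : Type*) [Field F] {n : ℕ} (D : RoundDiagram n) :
    RoundSpace F n :=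
  Submodule.Quotient.mk (Finsupp.single D 1)

/-! ### Closing horizontal chord diagrams -/

/-- The place of an end of a chord: the strand on which it lies, and its height on that strand.
The ends of the `k`-th chord are `(k, false)` on its first strand and `(k, true)` on its second.
The lexicographic order is the order in which a traveller meets the
ends on strand `0`, then on strand `1`, and so on. -/
def HorizontalDiagram.place {N n : ℕ} (D : HorizontalDiagram N n) (e : Fin n × Bool) :
    Fin N ×ₗ Fin n :=
  toLex (bif e.2 then (D.get e.1).1.2 else (D.get e.1).1.1, e.1)

theorem HorizontalDiagram.place_injective {N n : ℕ} (D : HorizontalDiagram N n) :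
    Function.Injective D.place := by
  rintro ⟨a, s⟩ ⟨b, t⟩ h
  have h' := toLex.injective h
  obtain ⟨h1, h2⟩ := Prod.mk.inj h'
  have h2' : a = b := h2
  subst h2'
  have hlt := (D.get a).2
  cases s <;> cases t <;> simp_all

/-- The set of all places of ends of chords. -/
def HorizontalDiagram.places {N n : ℕ} (D : HorizontalDiagram N n) : Finset (Fin N ×ₗ Fin n) :=
  Finset.univ.map ⟨D.place, D.place_injective⟩

theorem HorizontalDiagram.card_places {N n : ℕ} (D : HorizontalDiagram N n) :
    D.places.card = 2 * n := by
  simp [HorizontalDiagram.places, mul_comm]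

/-- The number of an end of a chord along the closed-up strands. -/
noncomputable def HorizontalDiagram.position {N n : ℕ} (D : HorizontalDiagram N n) :
    Fin n × Bool ≃ Fin (2 * n) :=
  (Equiv.ofBijective
    (fun e => (⟨D.place e, Finset.mem_map_of_mem _ (Finset.mem_univ e)⟩ : D.places))
    ⟨fun _ _ h => D.place_injective (Subtype.ext_iff.1 h), fun y => by
      obtain ⟨e, -, he⟩ := Finset.mem_map.1 y.2
      exact ⟨e, Subtype.ext he⟩⟩).trans
  (D.places.orderIsoOfFin D.card_places).symm.toEquiv

/-- Interchange of the two ends of each chord. -/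
def swapEnds (n : ℕ) : Equiv.Perm (Fin n × Bool) :=
  Equiv.prodCongr (Equiv.refl _) Equiv.boolNot

/-- The closure of a horizontal chord diagram along the cyclic permutation of its strands: the
end of each strand is joined to the start of the next one, and the end of the last strand
to the start of the first. -/
noncomputable def HorizontalDiagram.close {N n : ℕ} (D : HorizontalDiagram N n) :
    RoundDiagram n :=
  BasedRound.toRound
    { mate := (D.position.symm.trans (swapEnds n)).trans D.position
      mate_mate := fun x => by
        have h : ∀ e, swapEnds n (swapEnds n e) = e := by
          rintro ⟨k, s⟩
          simp [swapEnds]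
        simp [h]
      mate_ne := fun x h => by
        have h' := (D.position.eq_symm_apply).2 h
        have h'' := congrArg Prod.snd h'
        simp [swapEnds] at h'' }

/-! ### Jacobi diagrams -/

/-- The half-edges, other than those on the circle, of a trivalent diagram with `m` external
vertices (on the circle) and `q` internal ones: one at each external vertex, and
three at each internal one. -/
abbrev HalfEdge (m q : ℕ) : Type := Fin m ⊕ (Fin q × Fin 3)

/-- The vertex at which a half-edge is attached. -/
def HalfEdge.vertex {m q : ℕ} : HalfEdge m q → Fin m ⊕ Fin q :=
  Sum.map id Prod.fst

/-- A Jacobi diagram with labelled vertices. The external vertices `0, …, m-1` lie in this order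
along the oriented circle, and the three half-edges at an internal vertex `v` carry the cyclic
orientation `(v,0), (v,1), (v,2)`. The half-edges are joined in pairs to edges. The last
condition says that the graph, including the circle, is connected. -/
structure LabelledJacobi (m q : ℕ) where
  /-- the other half of the edge to which a half-edge belongs -/
  mate : Equiv.Perm (HalfEdge m q)
  mate_mate : ∀ h, mate (mate h) = h
  mate_ne : ∀ h, mate h ≠ h
  connected : ∀ v : Fin q, ∃ p : Fin m,
    Relation.ReflTransGen (fun a b => ∃ h : HalfEdge m q, h.vertex = a ∧ (mate h).vertex = b)
      (Sum.inr v) (Sum.inl p)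

/-- Relabelling: rotate the circle by `c`, permute the internal vertices by `f`, and rotate
the half-edges at each internal vertex `v` by `r v`. -/
def relabel {m q : ℕ} (c : ℤ) (f : Equiv.Perm (Fin q)) (r : Fin q → Fin 3) :
    HalfEdge m q → HalfEdge m q
  | Sum.inl i => Sum.inl (((finRotate m) ^ c) i)
  | Sum.inr (v, s) => Sum.inr (f v, s + r v)

theorem relabel_zero {m q : ℕ} (h : HalfEdge m q) :
    relabel 0 (Equiv.refl _) (fun _ => 0) h = h := by
  rcases h with i | ⟨v, s⟩ <;> simp [relabel]

theorem relabel_relabel {m q : ℕ} (c d : ℤ) (f g : Equiv.Perm (Fin q)) (r t : Fin q → Fin 3)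
    (h : HalfEdge m q) :
    relabel d g t (relabel c f r h) =
      relabel (d + c) (f.trans g) (fun v => r v + t (f v)) h := by
  rcases h with i | ⟨v, s⟩
  · simp [relabel, zpow_add]
  · simp [relabel, add_assoc]

theorem relabel_symm_relabel {m q : ℕ} (c : ℤ) (f : Equiv.Perm (Fin q)) (r : Fin q → Fin 3)
    (h : HalfEdge m q) :
    relabel (-c) f.symm (fun v => -r (f.symm v)) (relabel c f r h) = h := by
  rw [relabel_relabel]
  rcases h with i | ⟨v, s⟩ <;> simp [relabel]

theorem relabel_relabel_symm {m q : ℕ} (c : ℤ) (f : Equiv.Perm (Fin q)) (r : Fin q → Fin 3)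
    (h : HalfEdge m q) :
    relabel c f r (relabel (-c) f.symm (fun v => -r (f.symm v)) h) = h := by
  rw [relabel_relabel]
  rcases h with i | ⟨v, s⟩ <;> simp [relabel]

/-- Isomorphism of labelled Jacobi diagrams. -/
def LabelledJacobi.setoid (m q : ℕ) : Setoid (LabelledJacobi m q) where
  r D E := ∃ (c : ℤ) (f : Equiv.Perm (Fin q)) (r : Fin q → Fin 3),
    ∀ h, relabel c f r (D.mate h) = E.mate (relabel c f r h)
  iseqv :=
    { refl := fun D => ⟨0, Equiv.refl _, fun _ => 0, fun h => by simp only [relabel_zero]⟩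
      symm := by
        rintro D E ⟨c, f, r, H⟩
        refine ⟨-c, f.symm, fun v => -r (f.symm v), fun h => ?_⟩
        have h1 := H (relabel (-c) f.symm (fun v => -r (f.symm v)) h)
        rw [relabel_relabel_symm] at h1
        rw [← h1, relabel_symm_relabel]
      trans := by
        rintro D E G ⟨c, f, r, H⟩ ⟨d, g, t, K⟩
        refine ⟨d + c, f.trans g, fun v => r v + t (f v), fun h => ?_⟩
        rw [← relabel_relabel, ← relabel_relabel, H, K] }

/-- Jacobi diagrams of degree `n`, that is, with `2n` vertices. -/
def JacobiDiagram (n : ℕ) : Type :=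
  Σ p : {p : ℕ × ℕ // p.1 + p.2 = 2 * n}, Quotient (LabelledJacobi.setoid p.1.1 p.1.2)

/-- The Jacobi diagram underlying a labelled one. -/
def LabelledJacobi.toJacobi {m q n : ℕ} (D : LabelledJacobi m q) (h : m + q = 2 * n) :
    JacobiDiagram n :=
  ⟨⟨(m, q), h⟩, Quotient.mk (LabelledJacobi.setoid m q) D⟩

/-- Suppose that in a diagram the last external vertex is joined to the half-edge `0` of the last
internal vertex `v`. Delete these two vertices and the edge between them, put two consecutive
external vertices in place of the external one, and attach the half-edge `(v, s)` to the
first and `(v, t)` to the second of them. This is the resulting correspondence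
of half-edges. -/
def resolveHalfEdge {m q : ℕ} (s t : Fin 3) : HalfEdge (m + 2) q → HalfEdge (m + 1) (q + 1)
  | Sum.inl i =>
      Fin.lastCases (motive := fun _ => HalfEdge (m + 1) (q + 1)) (Sum.inr (Fin.last q, t))
        (fun j => Fin.lastCases (motive := fun _ => HalfEdge (m + 1) (q + 1))
          (Sum.inr (Fin.last q, s)) (fun k => Sum.inl k.castSucc) j) i
  | Sum.inr (v, k) => Sum.inr (v.castSucc, k)

/-- `E` is obtained from `D` by that operation. -/
def IsResolution {m q : ℕ} (s t : Fin 3) (D : LabelledJacobi (m + 1) (q + 1))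
    (E : LabelledJacobi (m + 2) q) : Prop :=
  ∀ h, resolveHalfEdge s t (E.mate h) = D.mate (resolveHalfEdge s t h)

/-- The STU relators `[S] - ([T] - [U])`: in `S` an internal vertex, with half-edges
`(leg, a, b)` in cyclic orientation, is joined by its leg to the circle; in `T` the
half-edges `b, a`, and in `U` the half-edges `a, b`, are attached to the circle in this order. -/
def stuRelators (F : Type*) [Field F] (n : ℕ) : Set (JacobiDiagram n →₀ F) :=
  {r | ∃ (m q : ℕ) (h₁ : (m + 1) + (q + 1) = 2 * n) (h₂ : (m + 2) + q = 2 * n)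
      (S : LabelledJacobi (m + 1) (q + 1)) (T U : LabelledJacobi (m + 2) q),
      S.mate (Sum.inl (Fin.last m)) = Sum.inr (Fin.last q, 0) ∧
      IsResolution 2 1 S T ∧ IsResolution 1 2 S U ∧
      r = Finsupp.single (S.toJacobi h₁) 1
        - (Finsupp.single (T.toJacobi h₂) 1 - Finsupp.single (U.toJacobi h₂) 1)}

/-- The degree `n` part of the space of Jacobi diagrams modulo STU. -/
abbrev JacobiSpace (F : Type*) [Field F] (n : ℕ) : Type _ :=
  (JacobiDiagram n →₀ F) ⧸ Submodule.span F (stuRelators F n)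

/-- The class of a Jacobi diagram modulo STU. -/
noncomputable def JacobiDiagram.toSpace (F : Type*) [Field F] {n : ℕ} (D : JacobiDiagram n) :
    JacobiSpace F n :=
  Submodule.Quotient.mk (Finsupp.single D 1)

/-- A based round chord diagram as a labelled Jacobi diagram without internal vertices. -/
def BasedRound.toLabelledJacobi {n : ℕ} (D : BasedRound n) : LabelledJacobi (2 * n) 0 where
  mate := Equiv.sumCongr D.mate (Equiv.refl _)
  mate_mate := by
    rintro (x | ⟨v, -⟩)
    · simp [D.mate_mate]
    · exact v.elim0
  mate_ne := by
    rintro (x | ⟨v, -⟩)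
    · simpa using D.mate_ne x
    · exact v.elim0
  connected := fun v => v.elim0

/-- The inclusion of round chord diagrams into Jacobi diagrams. -/
def RoundDiagram.toJacobi {n : ℕ} (D : RoundDiagram n) : JacobiDiagram n :=
  ⟨⟨(2 * n, 0), rfl⟩,
    Quotient.map (sa := BasedRound.setoid n) (sb := LabelledJacobi.setoid (2 * n) 0)
      BasedRound.toLabelledJacobi
      (by
        rintro D E ⟨c, hc⟩
        refine ⟨c, Equiv.refl _, fun _ => 0, ?_⟩
        rintro (x | ⟨v, -⟩)
        · exact congrArg Sum.inl (hc x)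
        · exact v.elim0) D⟩

/-! ### Weight systems -/

/-- The graded linear dual of a graded vector space. -/
abbrev GradedDual (F : Type*) [Field F] (A : ℕ → Type*) [∀ n, AddCommMonoid (A n)]
    [∀ n, Module F (A n)] : Type _ :=
  ⨁ n, Module.Dual F (A n)

/-- The linear map of graded duals that is dual to a graded linear map. -/
noncomputable def gradedDualMap {F : Type*} [Field F] {A B : ℕ → Type*}
    [∀ n, AddCommMonoid (A n)] [∀ n, Module F (A n)]
    [∀ n, AddCommMonoid (B n)] [∀ n, Module F (B n)] (f : ∀ n, A n →ₗ[F] B n) :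
    GradedDual F B →ₗ[F] GradedDual F A :=
  DirectSum.lmap fun n => (f n).dualMap

/-- The degree `n` part of the space of horizontal chord diagrams with any positive number of
strands, modulo the 2T and 4T relations. -/
abbrev HorizontalTotalSpace (F : Type*) [Field F] (n : ℕ) : Type _ :=
  ⨁ N : ℕ+, HorizontalSpace F N n

/-- Weight systems on horizontal chord diagrams with any positive number of strands. -/
abbrev HorizontalTotalWeights (F : Type*) [Field F] : Type _ :=
  GradedDual F (HorizontalTotalSpace F)

/-- Weight systems on round chord diagrams. -/
abbrev RoundWeights (F : Type*) [Field F] : Type _ := GradedDual F (RoundSpace F)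

/-- Weight systems on Jacobi diagrams. -/
abbrev JacobiWeights (F : Type*) [Field F] : Type _ := GradedDual F (JacobiSpace F)

end ChordDiagrams

namespace ChordDiagrams

/-! ### Abstract diagrams -/

/-! The bridge between the two kinds of diagrams is that 4T is a difference of two STU relations.
Put an internal vertex on a chord and attach a further edge there; resolving this vertex at either
foot of the chord gives the two halves of a 4T relation. Hence every isomorphism invariant function
satisfying STU satisfies 4T (`IsSTU.fourT`), and the inclusion of chord diagrams descends to the
quotients. It is onto, because connectedness provides every diagram having internal vertices with a
leg, that is, an edge from the circle to an internal vertex, and STU at a leg lowers the number of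
internal vertices (`jacobiClass_mem_range`).

For injectivity a left inverse is built by resolving legs recursively, each time at an arbitrary
leg. Independence of the choice (`stuDiff_eq`) is proved by induction on the number of internal
vertices. Legs at distinct vertices commute: both orders lead to the same four diagrams. For two
legs at one vertex, a leg at another vertex serves as an intermediary if there is one. Otherwise
look at the third edge of the vertex. If it ends on the circle, connectedness leaves no other
internal vertex, and the claim is a 4T relation (`stuDiff_tripod`). If it ends at another internal
vertex, each resolved diagram has exactly one leg, and such diagrams vanish (`IsSTU.eq_zero`):
resolving that leg gives the difference of two diagrams related by carrying one end around the whole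
circle, a sum of 4T relations.

These arguments use diagrams with half-edges in an arbitrary type, a `Cycle` for the circle and a
multiset of cycles for the internal vertices. Rotations and relabellings of the vertices then become
equalities, and isomorphisms become renamings of half-edges. `IsSTU n q` bounds the number of
internal vertices, so that it can serve as the induction hypothesis.

Closing respects 2T, since the order of the ends on each strand does not change, and takes
horizontal 4T to round 4T (`fourTerm_close_of_lt`). Cutting a based round diagram before the second
end of each of its `n` chords leaves `n + 1` arcs, which serve as strands of a horizontal diagram
with that closure (`exists_close_eq`). So closing is onto when `n < N`, and its dual is injective.
-/

/-- A pairing of the elements of a type. -/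
structure Pairing (K : Type) where
  /-- the partner of an element -/
  mate : K → K
  mate_mate : ∀ k, mate (mate k) = k
  mate_ne : ∀ k, mate k ≠ k

theorem Pairing.mate_inj {K : Type} (σ : Pairing K) {a b : K} : σ.mate a = σ.mate b ↔ a = b :=
  ⟨fun h => by rw [← σ.mate_mate a, h, σ.mate_mate], fun h => h ▸ rfl⟩

/-- A map that respects the pairings. -/
structure PairingEmb {K K' : Type} (σ : Pairing K) (σ' : Pairing K') where
  /-- the underlying map -/
  toFun : K → K'
  inj : Function.Injective toFun
  map_mate : ∀ k, toFun (σ.mate k) = σ'.mate (toFun k)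

/-- A diagram whose half-edges are taken from a type `K`: the half-edges on the
circle in their cyclic order, and those at the internal vertices. -/
@[ext] structure Diag (K : Type) where
  /-- the half-edges attached to the circle -/
  circ : Cycle K
  /-- the cyclically ordered half-edges at the internal vertices -/
  ints : Multiset (Cycle K)

section

variable {K K' : Type}

/-- A diagram given by the list of its half-edges on the circle. -/
def dg (L : List K) (I : Multiset (Cycle K)) : Diag K := ⟨(L : Cycle K), I⟩

/-- Three cyclically ordered half-edges. -/
def tri (a b c : K) : Cycle K := (([a, b, c] : List K) : Cycle K)

theorem tri_rotate (a b c : K) : tri a b c = tri b c a :=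
  Cycle.coe_eq_coe.2 ⟨1, rfl⟩

@[simp] theorem mem_tri {a b c k : K} : k ∈ tri a b c ↔ k = a ∨ k = b ∨ k = c := by
  simp [tri]

@[simp] theorem dg_circ (L : List K) (I : Multiset (Cycle K)) : (dg L I).circ = (L : Cycle K) := rfl

@[simp] theorem dg_ints (L : List K) (I : Multiset (Cycle K)) : (dg L I).ints = I := rfl

theorem dg_append_comm (A B : List K) (I : Multiset (Cycle K)) :
    dg (A ++ B) I = dg (B ++ A) I := by
  rw [dg, dg, Cycle.coe_eq_coe.2 List.isRotated_append]

/-- All half-edges of a diagram. -/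
def Diag.supp (D : Diag K) : Multiset K := D.circ.toMultiset + D.ints.bind Cycle.toMultiset

/-- The image of a diagram under a map of half-edges. -/
def Diag.map (f : K → K') (D : Diag K) : Diag K' := ⟨D.circ.map f, D.ints.map (Cycle.map f)⟩

@[simp] theorem tri_map (f : K → K') (a b c : K) : (tri a b c).map f = tri (f a) (f b) (f c) := rfl

@[simp] theorem dg_map (f : K → K') (L : List K) (I : Multiset (Cycle K)) :
    (dg L I).map f = dg (L.map f) (I.map (Cycle.map f)) := rfl

theorem mem_toMultiset {k : K} {c : Cycle K} : k ∈ c.toMultiset ↔ k ∈ c := by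
  induction c using Quotient.inductionOn' with
  | h l => simp

theorem Diag.mem_supp {D : Diag K} {k : K} :
    k ∈ D.supp ↔ k ∈ D.circ ∨ ∃ t ∈ D.ints, k ∈ t := by
  simp [Diag.supp, mem_toMultiset]

@[simp] theorem supp_dg (L : List K) (I : Multiset (Cycle K)) :
    (dg L I).supp = (L : Multiset K) + I.bind Cycle.toMultiset := rfl

theorem toMultiset_tri (a b c : K) : (tri a b c).toMultiset = a ::ₘ b ::ₘ c ::ₘ 0 := rfl

theorem toMultiset_map (f : K → K') (c : Cycle K) :
    (c.map f).toMultiset = c.toMultiset.map f := by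
  induction c using Quotient.inductionOn' with
  | h l => rfl

theorem Diag.supp_map (f : K → K') (D : Diag K) : (D.map f).supp = D.supp.map f := by
  simp only [Diag.supp, Diag.map, Multiset.map_add, Multiset.map_bind, Multiset.bind_map,
    toMultiset_map]

/-- The diagrams of degree `n` whose edges are given by the pairing `σ`. -/
structure Diag.Valid (σ : Pairing K) (n : ℕ) (D : Diag K) : Prop where
  nodup : D.supp.Nodup
  closed : ∀ k ∈ D.supp, σ.mate k ∈ D.supp
  three : ∀ t ∈ D.ints, ∃ a b c, t = tri a b c
  -- Connectedness without paths: a set of half-edges that is stable under passing along edges and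
  -- through internal vertices, and avoids the circle, contains no half-edge of an internal vertex.
  conn : ∀ P : K → Prop, (∀ k, P k → P (σ.mate k)) →
    (∀ t ∈ D.ints, ∀ a ∈ t, ∀ b ∈ t, P a → P b) → (∀ k ∈ D.circ, ¬ P k) →
    ∀ t ∈ D.ints, ∀ a ∈ t, ¬ P a
  card : D.circ.length + Multiset.card D.ints = 2 * n

/-! ### Valid diagrams and the resolution of a leg -/

variable {σ : Pairing K} {σ' : Pairing K'} {n : ℕ}

/-- Resolving a leg deletes just the two halves of its edge; the other two half-edges of the vertex
move to the circle. -/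
theorem supp_leg (L : List K) (x a b : K) (I : Multiset (Cycle K)) :
    (dg (x :: L) (tri (σ.mate x) a b ::ₘ I)).supp =
      x ::ₘ σ.mate x ::ₘ (dg (b :: a :: L) I).supp := by
  simp only [supp_dg, Multiset.cons_bind, toMultiset_tri]
  simp only [← Multiset.cons_coe, ← Multiset.singleton_add, add_zero]
  abel

/-- Validity ignores the order on the circle, so the two terms `T` and `U` of STU are valid
together. -/
theorem Diag.Valid.perm {L L' : List K} {I : Multiset (Cycle K)} (h : (dg L I).Valid σ n)
    (p : L.Perm L') : (dg L' I).Valid σ n := by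
  have e : (dg L I).supp = (dg L' I).supp := by simp [Multiset.coe_eq_coe.2 p]
  refine ⟨e ▸ h.nodup, e ▸ h.closed, h.three, ?_, ?_⟩
  · intro P h1 h2 h3
    refine h.conn P h1 h2 fun k hk => h3 k ?_
    simpa [p.mem_iff] using hk
  · simpa [p.length_eq] using h.card

/-- Connectedness survives because whatever reached the circle through the deleted vertex did so
through `a` or `b`, which now lie on the circle. -/
theorem Diag.Valid.resolve {L : List K} {x a b : K} {I : Multiset (Cycle K)}
    (h : (dg (x :: L) (tri (σ.mate x) a b ::ₘ I)).Valid σ n) : (dg (b :: a :: L) I).Valid σ n := by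
  have nd := h.nodup
  have e := supp_leg (σ := σ) L x a b I
  rw [e] at nd
  simp only [Multiset.nodup_cons] at nd
  obtain ⟨n1, n2, n3⟩ := nd
  refine ⟨n3, ?_, fun t ht => h.three t (Multiset.mem_cons_of_mem ht), ?_, ?_⟩
  · intro k hk
    have := h.closed k (by rw [e]; simp [-supp_dg, hk])
    rw [e] at this
    simp only [Multiset.mem_cons] at this
    rcases this with h1 | h1 | h1
    · rw [← h1, σ.mate_mate] at n2
      exact absurd hk n2
    · rw [σ.mate_inj] at h1
      subst h1
      exact absurd (Multiset.mem_cons_of_mem hk) n1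
    · exact h1
  · intro P h1 h2 h3
    -- Nothing is known about `P` on the deleted edge, so that edge is removed from `P` before
    -- connectedness of the larger diagram is applied.
    have key := h.conn (fun k => P k ∧ k ≠ x ∧ k ≠ σ.mate x) ?_ ?_ ?_
    · intro t ht c hc hPc
      refine key t (Multiset.mem_cons_of_mem ht) c hc ⟨hPc, ?_⟩
      have hs : c ∈ (dg (b :: a :: L) I).supp := Diag.mem_supp.2 (Or.inr ⟨t, ht, hc⟩)
      constructor
      · rintro rfl
        exact n1 (Multiset.mem_cons_of_mem hs)
      · rintro rfl
        exact n2 hs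
    · rintro k ⟨hk, hx, hx'⟩
      refine ⟨h1 k hk, fun he => hx' ?_, fun he => hx (σ.mate_inj.1 he)⟩
      rw [← he, σ.mate_mate]
    · intro t ht c hc d hd
      simp only [dg_ints, Multiset.mem_cons] at ht
      rcases ht with rfl | ht
      · have ha : ¬ P a := h3 a (by simp)
        have hb : ¬ P b := h3 b (by simp)
        rintro ⟨hPc, hx, hx'⟩
        simp only [mem_tri] at hc
        rcases hc with rfl | rfl | rfl <;> simp_all
      · rintro ⟨hPc, -⟩
        refine ⟨h2 t ht c hc d hd hPc, ?_⟩
        have hs : d ∈ (dg (b :: a :: L) I).supp := Diag.mem_supp.2 (Or.inr ⟨t, ht, hd⟩)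
        constructor
        · rintro rfl
          exact n1 (Multiset.mem_cons_of_mem hs)
        · rintro rfl
          exact n2 hs
    · intro k hk
      simp only [dg_circ, Cycle.mem_coe_iff, List.mem_cons] at hk
      rintro ⟨hPk, hx, -⟩
      rcases hk with hk | hk
      · exact hx hk
      · exact h3 k (by simp [hk]) hPk
  · have := h.card
    simp only [dg_circ, dg_ints, Cycle.length_coe, List.length_cons, Multiset.card_cons] at this ⊢
    omega

/-- The converse creates an internal vertex from two neighbouring ends and an unused edge; this is
how STU yields 4T. -/
theorem Diag.Valid.unresolve {L : List K} {x a b : K} {I : Multiset (Cycle K)}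
    (h : (dg (b :: a :: L) I).Valid σ n) (hx : x ∉ (dg (b :: a :: L) I).supp)
    (hx' : σ.mate x ∉ (dg (b :: a :: L) I).supp) :
    (dg (x :: L) (tri (σ.mate x) a b ::ₘ I)).Valid σ n := by
  have e := supp_leg (σ := σ) L x a b I
  refine ⟨?_, ?_, ?_, ?_, ?_⟩
  · rw [e]
    simp only [Multiset.nodup_cons, Multiset.mem_cons, not_or]
    exact ⟨⟨(σ.mate_ne x).symm, hx⟩, hx', h.nodup⟩
  · intro k hk
    rw [e] at hk ⊢
    simp only [Multiset.mem_cons] at hk ⊢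
    rcases hk with rfl | rfl | hk
    · simp
    · simp [σ.mate_mate]
    · exact Or.inr (Or.inr (h.closed k hk))
  · intro t ht
    simp only [dg_ints, Multiset.mem_cons] at ht
    rcases ht with rfl | ht
    · exact ⟨_, _, _, rfl⟩
    · exact h.three t ht
  · intro P h1 h2 h3
    have hx1 : ¬ P x := h3 x (by simp)
    have hx2 : ¬ P (σ.mate x) := fun hp => hx1 (by simpa [σ.mate_mate] using h1 _ hp)
    have ht1 : ∀ c ∈ tri (σ.mate x) a b, ¬ P c := fun c hc hp =>
      hx2 (h2 _ (by simp) c hc _ (by simp) hp)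
    intro t ht
    simp only [dg_ints, Multiset.mem_cons] at ht
    rcases ht with rfl | ht
    · exact ht1
    · refine h.conn P h1 (fun t ht => h2 t (Multiset.mem_cons_of_mem ht)) ?_ t ht
      intro k hk
      simp only [dg_circ, Cycle.mem_coe_iff, List.mem_cons] at hk
      rcases hk with rfl | rfl | hk
      · exact ht1 _ (by simp)
      · exact ht1 _ (by simp)
      · exact h3 k (by simp [hk])
  · have := h.card
    simp only [dg_circ, dg_ints, Cycle.length_coe, List.length_cons, Multiset.card_cons] at this ⊢
    omega

theorem Diag.Valid.map {D : Diag K} (h : D.Valid σ n) (f : PairingEmb σ σ') :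
    (D.map f.toFun).Valid σ' n := by
  refine ⟨?_, ?_, ?_, ?_, ?_⟩
  · rw [Diag.supp_map]
    exact h.nodup.map f.inj
  · intro k hk
    rw [Diag.supp_map] at hk ⊢
    obtain ⟨l, hl, rfl⟩ := Multiset.mem_map.1 hk
    rw [← f.map_mate]
    exact Multiset.mem_map_of_mem _ (h.closed l hl)
  · intro t ht
    obtain ⟨s, hs, rfl⟩ := Multiset.mem_map.1 ht
    obtain ⟨a, b, c, rfl⟩ := h.three s hs
    exact ⟨_, _, _, rfl⟩
  · intro P h1 h2 h3 t ht a ha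
    obtain ⟨s, hs, rfl⟩ := Multiset.mem_map.1 ht
    obtain ⟨c, hc, rfl⟩ := Cycle.mem_map.1 ha
    refine h.conn (fun k => P (f.toFun k)) ?_ ?_ ?_ s hs c hc
    · intro k hk
      simpa only [f.map_mate] using h1 _ hk
    · intro t ht c hc d hd
      exact h2 _ (Multiset.mem_map_of_mem _ ht) _ (Cycle.mem_map.2 ⟨c, hc, rfl⟩) _
        (Cycle.mem_map.2 ⟨d, hd, rfl⟩)
    · intro k hk
      exact h3 _ (Cycle.mem_map.2 ⟨k, hk, rfl⟩)
  · have := h.card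
    have e : ∀ c : Cycle K, (c.map f.toFun).length = c.length := by
      intro c
      induction c using Quotient.inductionOn' with
      | h l => exact List.length_map _
    simpa [Diag.map, e] using this

/-! ### Existence of legs, and cycles read from a given element -/

theorem exists_cons_of_mem_cycle {c : Cycle K} {x : K} (h : x ∈ c) :
    ∃ L : List K, c = ((x :: L : List K) : Cycle K) := by
  induction c using Quotient.inductionOn' with
  | h l =>
    obtain ⟨A, B, rfl⟩ := List.append_of_mem (Cycle.mem_coe_iff.1 h)
    exact ⟨B ++ A, Cycle.coe_eq_coe.2 (List.isRotated_append (l := A) (l' := x :: B))⟩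

theorem exists_tri_of_mem {t : Cycle K} {x : K} (ht : ∃ a b c, t = tri a b c) (h : x ∈ t) :
    ∃ a b, t = tri x a b := by
  obtain ⟨a, b, c, rfl⟩ := ht
  simp only [mem_tri] at h
  rcases h with rfl | rfl | rfl
  · exact ⟨_, _, rfl⟩
  · exact ⟨_, _, tri_rotate _ _ _⟩
  · exact ⟨_, _, (tri_rotate _ _ _).symm⟩

theorem exists_leg_of_mem {D : Diag K} (h : ∀ t ∈ D.ints, ∃ a b c, t = tri a b c) {x : K}
    {t : Cycle K} (hx : x ∈ D.circ) (ht : t ∈ D.ints) (hxt : σ.mate x ∈ t) :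
    ∃ L a b I, D = dg (x :: L) (tri (σ.mate x) a b ::ₘ I) ∧ t = tri (σ.mate x) a b := by
  obtain ⟨L, hL⟩ := exists_cons_of_mem_cycle hx
  obtain ⟨a, b, rfl⟩ := exists_tri_of_mem (h t ht) hxt
  obtain ⟨I, hI⟩ := Multiset.exists_cons_of_mem ht
  exact ⟨L, a, b, I, Diag.ext hL hI, rfl⟩

/-- Without a leg, the half-edges at internal vertices would be closed under passing along edges and
would avoid the circle, against connectedness. -/
theorem Diag.Valid.exists_mem {D : Diag K} (h : D.Valid σ n) (h0 : D.ints ≠ 0) :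
    ∃ x t, x ∈ D.circ ∧ t ∈ D.ints ∧ σ.mate x ∈ t := by
  by_contra! H
  obtain ⟨t, ht⟩ := Multiset.exists_mem_of_ne_zero h0
  obtain ⟨a, b, c, rfl⟩ := h.three t ht
  have nd := h.nodup
  rw [Diag.supp, Multiset.nodup_add] at nd
  refine h.conn (fun k => ∃ t ∈ D.ints, k ∈ t) ?_ ?_ ?_ _ ht a (by simp) ⟨_, ht, by simp⟩
  · rintro k ⟨t, ht, hk⟩
    have := h.closed k (Diag.mem_supp.2 (Or.inr ⟨t, ht, hk⟩))
    rcases Diag.mem_supp.1 this with h1 | h1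
    · exact absurd (by rwa [σ.mate_mate]) (H _ _ h1 ht)
    · exact h1
  · intro t ht a _ b hb _
    exact ⟨t, ht, hb⟩
  · rintro k hk ⟨t, ht, hkt⟩
    exact Multiset.disjoint_left.1 nd.2.2 (mem_toMultiset.2 hk)
      (Multiset.mem_bind.2 ⟨t, ht, mem_toMultiset.2 hkt⟩)

theorem Diag.Valid.exists_leg {D : Diag K} (h : D.Valid σ n) (h0 : D.ints ≠ 0) :
    ∃ x L a b I, D = dg (x :: L) (tri (σ.mate x) a b ::ₘ I) := by
  obtain ⟨x, t, hx, ht, hxt⟩ := h.exists_mem h0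
  obtain ⟨L, a, b, I, h1, -⟩ := exists_leg_of_mem h.three hx ht hxt
  exact ⟨x, L, a, b, I, h1⟩

/-- In a list without repetitions the head fixes the rotation. Hence a leg determines the rest of
the circle and the order of the other two half-edges at its vertex. -/
theorem eq_of_isRotated_cons {x : K} {L L' : List K} (nd : (x :: L).Nodup)
    (h : (x :: L) ~r (x :: L')) : L = L' := by
  obtain ⟨k, hk, h⟩ := List.isRotated_iff_mod.1 h
  have h0 : (x :: L).rotate k = (x :: L).rotate 0 := by
    rcases hk.eq_or_lt with hk | hk
    · rw [hk, List.rotate_length, List.rotate_zero]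
    · have h1 := List.head?_rotate hk
      rw [h] at h1
      have h2 : (x :: L)[k]? = (x :: L)[0]? := by rw [← h1]; rfl
      rw [List.getElem?_eq_getElem hk, List.getElem?_eq_getElem (by simp), Option.some_inj] at h2
      have := nd.getElem_inj_iff.1 h2
      rw [this]
  rw [h, List.rotate_zero] at h0
  exact (List.cons.inj h0).2.symm

theorem dg_cons_inj {x : K} {L L' : List K} {I I' : Multiset (Cycle K)}
    (nd : (x :: L).Nodup) (h : dg (x :: L) I = dg (x :: L') I') : L = L' ∧ I = I' :=
  ⟨eq_of_isRotated_cons nd (Cycle.coe_eq_coe.1 (congrArg Diag.circ h)), congrArg Diag.ints h⟩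

theorem tri_inj {x a b a' b' : K} (nd : [x, a, b].Nodup) (h : tri x a b = tri x a' b') :
    a = a' ∧ b = b' := by
  have := eq_of_isRotated_cons nd (Cycle.coe_eq_coe.1 h)
  simpa using this

end

/-! ### Functions satisfying the STU relation -/

/-- A function of diagrams of degree `n` that does not depend on the names of the half-edges and
satisfies STU for diagrams with at most `q` internal vertices. -/
structure IsSTU {M : Type*} [AddCommGroup M] (n q : ℕ)
    (Φ : ∀ K : Type, Pairing K → Diag K → M) : Prop where
  map : ∀ {K K' : Type} {σ : Pairing K} {σ' : Pairing K'} (f : PairingEmb σ σ') {D : Diag K},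
    D.Valid σ n → Multiset.card D.ints ≤ q → Φ K' σ' (D.map f.toFun) = Φ K σ D
  stu : ∀ {K : Type} {σ : Pairing K} {x : K} {L : List K} {a b : K} {I : Multiset (Cycle K)},
    (dg (x :: L) (tri (σ.mate x) a b ::ₘ I)).Valid σ n → Multiset.card I < q →
    Φ K σ (dg (x :: L) (tri (σ.mate x) a b ::ₘ I)) =
      Φ K σ (dg (b :: a :: L) I) - Φ K σ (dg (a :: b :: L) I)

section

variable {K : Type}

/-- A pairing with one more edge. -/
def Pairing.addEdge (σ : Pairing K) : Pairing (K ⊕ Bool) where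
  mate := Sum.map σ.mate not
  mate_mate := by rintro (k | s) <;> simp [σ.mate_mate]
  mate_ne := by rintro (k | s) <;> simp [σ.mate_ne]

/-- The inclusion into the pairing with one more edge. -/
def Pairing.inlEmb (σ : Pairing K) : PairingEmb σ σ.addEdge where
  toFun := Sum.inl
  inj := Sum.inl_injective
  map_mate _ := rfl

open Classical in
/-- The exchange of the new edge with the edge of `y`. -/
noncomputable def Pairing.exchange (σ : Pairing K) (y : K) :
    PairingEmb σ.addEdge σ.addEdge where
  toFun := Sum.elim (fun k => if k = y then Sum.inr true else
    if k = σ.mate y then Sum.inr false else Sum.inl k)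
    (fun s => if s then Sum.inl (σ.mate y) else Sum.inl y)
  inj := by
    have h := σ.mate_ne y
    rintro (k | s) (l | t) H <;> simp only [Sum.elim_inl, Sum.elim_inr] at H <;>
      split_ifs at H <;> grind
  map_mate := by
    have h := σ.mate_ne y
    have h' : ∀ k, σ.mate k = y ↔ k = σ.mate y := fun k => by
      rw [← σ.mate_inj, σ.mate_mate]
    rintro (k | s)
    · simp only [Pairing.addEdge, Sum.map_inl, Sum.elim_inl, h', σ.mate_inj]
      split_ifs <;> simp_all
    · cases s <;> simp [Pairing.addEdge, σ.mate_mate]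

theorem Cycle.map_eq_of_forall {K' : Type} {f g : K → K'} {c : Cycle K} (h : ∀ k ∈ c, f k = g k) :
    c.map f = c.map g := by
  induction c using Quotient.inductionOn' with
  | h l =>
    exact congrArg (fun l : List K' => (l : Cycle K'))
      (List.map_congr_left fun k hk => h k (Cycle.mem_coe_iff.2 hk))

/-! ### The 4T relation and its consequences -/

variable {M : Type*} [AddCommGroup M] {n q : ℕ} {Φ : ∀ K : Type, Pairing K → Diag K → M}
  {σ : Pairing K}

/-- The first difference is STU for the diagram in which `b` is attached to a vertex on the chord of
`y`, resolved at the foot near `y`. Resolving the same diagram at the foot near `σ.mate y` gives the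
negative of the second difference. The auxiliary diagram has one more internal vertex, hence the
strict bound on `I`. -/
theorem IsSTU.fourT (h : IsSTU n q Φ) {y b : K} {Q R : List K} {I : Multiset (Cycle K)}
    (hv : (dg (b :: y :: (Q ++ σ.mate y :: R)) I).Valid σ n) (hq : Multiset.card I < q) :
    Φ K σ (dg (b :: y :: (Q ++ σ.mate y :: R)) I) - Φ K σ (dg (y :: b :: (Q ++ σ.mate y :: R)) I)
      + (Φ K σ (dg (y :: (Q ++ b :: σ.mate y :: R)) I)
        - Φ K σ (dg (y :: (Q ++ σ.mate y :: b :: R)) I)) = 0 := by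
  have hv2 : (dg (y :: b :: (Q ++ σ.mate y :: R)) I).Valid σ n :=
    hv.perm (List.Perm.swap _ _ _)
  have hv4 : (dg (y :: (Q ++ σ.mate y :: b :: R)) I).Valid σ n := by
    refine hv2.perm (List.Perm.cons _ ?_)
    have e : Q ++ σ.mate y :: b :: R = (Q ++ [σ.mate y]) ++ b :: R := by simp
    rw [e]
    refine List.Perm.trans ?_ List.perm_middle.symm
    simp
  have hv3 : (dg (y :: (Q ++ b :: σ.mate y :: R)) I).Valid σ n :=
    hv4.perm (List.Perm.cons _ (List.Perm.append_left _ (List.Perm.swap _ _ _)))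
  -- The type `K` may have no unused edge, so everything is moved to `K ⊕ Bool`.
  rw [← h.map σ.inlEmb hv hq.le, ← h.map σ.inlEmb hv2 hq.le, ← h.map σ.inlEmb hv3 hq.le,
    ← h.map σ.inlEmb hv4 hq.le]
  have hw := hv.map σ.inlEmb
  have nd := hv.nodup
  simp only [supp_dg, Multiset.nodup_add, Multiset.coe_nodup, List.nodup_cons,
    List.mem_cons, List.mem_append, List.nodup_append, not_or] at nd
  obtain ⟨⟨⟨hby, hbQ, hby', hbR⟩, ⟨hyQ, hyy', hyR⟩, ndQ, ⟨hy'R, ndR⟩, hQR⟩, -, hI⟩ := nd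
  have hI' : ∀ t ∈ I, ∀ k ∈ t, k ≠ y ∧ k ≠ σ.mate y := by
    intro t ht k hk
    have := fun hk' : k ∈ ((b :: y :: (Q ++ σ.mate y :: R) : List K) : Multiset K) =>
      Multiset.disjoint_left.1 hI hk' (Multiset.mem_bind.2 ⟨t, ht, mem_toMultiset.2 hk⟩)
    simp only [Multiset.mem_coe, List.mem_cons, List.mem_append] at this
    tauto
  have hfix : ∀ k, k ≠ y → k ≠ σ.mate y → (σ.exchange y).toFun (Sum.inl k) = Sum.inl k := by
    intro k h1 h2
    simp [Pairing.exchange, h1, h2]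
  have hI2 : (I.map (Cycle.map σ.inlEmb.toFun)).map (Cycle.map (σ.exchange y).toFun) =
      I.map (Cycle.map σ.inlEmb.toFun) := by
    rw [Multiset.map_map]
    refine Multiset.map_congr rfl fun t ht => ?_
    have : ∀ c : Cycle K, (c.map σ.inlEmb.toFun).map (σ.exchange y).toFun =
        c.map ((σ.exchange y).toFun ∘ σ.inlEmb.toFun) := by
      intro c
      induction c using Quotient.inductionOn' with
      | h l => exact congrArg (Cycle.ofList) (List.map_map ..)
    rw [Function.comp_apply, this]
    exact Cycle.map_eq_of_forall fun k hk => hfix k (hI' t ht k hk).1 (hI' t ht k hk).2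
  have hL : ∀ L : List K, y ∉ L → σ.mate y ∉ L →
      (L.map σ.inlEmb.toFun).map (σ.exchange y).toFun = L.map σ.inlEmb.toFun := by
    intro L h1 h2
    rw [List.map_map]
    refine List.map_congr_left fun k hk => hfix k ?_ ?_
    · rintro rfl
      exact h1 hk
    · rintro rfl
      exact h2 hk
  have hQ := hL Q hyQ (fun hm => hQR _ hm _ (Or.inl rfl) rfl)
  have hR := hL R hyR hy'R
  have eb : (σ.exchange y).toFun (Sum.inl b) = Sum.inl b := hfix b hby hby'
  have ey' : (σ.exchange y).toFun (Sum.inl (σ.mate y)) = Sum.inr false := by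
    simp [Pairing.exchange, σ.mate_ne]
  have ey : (σ.exchange y).toFun (Sum.inl y) = Sum.inr true := by simp [Pairing.exchange]
  have ef : (σ.exchange y).toFun (Sum.inr false) = Sum.inl y := by simp [Pairing.exchange]
  have ef' : (σ.exchange y).toFun (Sum.inr true) = Sum.inl (σ.mate y) := by
    simp [Pairing.exchange]
  have hmem : ∀ s : Bool, (Sum.inr s : K ⊕ Bool) ∉
      ((dg (b :: y :: (Q ++ σ.mate y :: R)) I).map σ.inlEmb.toFun).supp := by
    intro s hs
    rw [Diag.supp_map] at hs
    obtain ⟨k, -, hk⟩ := Multiset.mem_map.1 hs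
    exact Sum.inl_ne_inr hk
  simp only [dg_map, List.map_cons, List.map_append] at hw hmem ⊢
  set Q' := Q.map σ.inlEmb.toFun
  set R' := R.map σ.inlEmb.toFun
  set I' := I.map (Cycle.map σ.inlEmb.toFun) with hI'def
  have hcard : Multiset.card I' < q := by simpa [hI'def] using hq
  have i1 : ∀ k, σ.inlEmb.toFun k = Sum.inl k := fun _ => rfl
  simp only [i1] at hw hmem ⊢
  -- The new edge joins the old place of `y` to a vertex with half-edges `inr true`, `y`, `b`, so
  -- the chord now consists of two edges. `exchange` swaps these two edges, end for end, which puts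
  -- the new edge at the other foot.
  have hs1 := hw.unresolve (x := Sum.inr false) (hmem _) (hmem true)
  have hs2 := hs1.map (σ.exchange y)
  have r1 := h.stu hs1 hcard
  have r2 := h.map (σ.exchange y) hs1 (by simpa using hcard)
  have m1 : σ.addEdge.mate (Sum.inr false) = Sum.inr true := rfl
  simp only [dg_map, List.map_cons, List.map_append, Multiset.map_cons, tri_map, m1, hQ, hR, hI2,
    eb, ey, ey', ef, ef'] at hs2 r1 r2
  have rot : ∀ A B : List (K ⊕ Bool), ∀ u, ∀ J,
      dg (u :: (A ++ B)) J = dg (B ++ u :: A) J :=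
    fun A B u J => dg_append_comm (u :: A) B J
  rw [tri_rotate, rot, List.cons_append] at hs2 r2
  have r3 := h.stu (x := Sum.inr false) hs2 hcard
  rw [m1] at r3
  rw [rot Q', rot Q', ← r1, ← r2]
  simp only [List.cons_append] at r3 ⊢
  rw [r3]
  abel

theorem insertIdx_append_length (A B : List K) (b : K) :
    (A ++ B).insertIdx A.length b = A ++ b :: B := by
  induction A with
  | nil => rfl
  | cons a A ih => simp [ih]

theorem list_split_two {W : List K} {i j : ℕ} (hij : i < j) (hj : j < W.length) :
    ∃ P Q R, W = P ++ W[i] :: (Q ++ W[j] :: R) ∧ P.length = i ∧ (P ++ W[i] :: Q).length = j := by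
  refine ⟨W.take i, (W.take j).drop (i + 1), W.drop (j + 1), ?_, by simp; omega, by simp; omega⟩
  have e1 : W = W.take j ++ W[j] :: W.drop (j + 1) := by simp
  have e2 : W.take j = W.take i ++ W[i] :: (W.take j).drop (i + 1) := by
    have := (List.take_append_drop i (W.take j)).symm
    rw [List.drop_eq_getElem_cons (by simp; omega)] at this
    simpa [List.take_take, hij.le] using this
  conv_lhs => rw [e1, e2]
  simp

/-- The form by positions of the moving end `b` is symmetric in the two ends of the fixed chord,
which makes it fit for summation over the whole circle. -/
theorem IsSTU.fourT_insertIdx (h : IsSTU n q Φ) {W : List K} {b : K} {I : Multiset (Cycle K)}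
    (hv : (dg (b :: W) I).Valid σ n) (hq : Multiset.card I < q) {i j : ℕ} (hi : i < W.length)
    (hj : j < W.length) (hij : W[j] = σ.mate W[i]) :
    Φ K σ (dg (W.insertIdx i b) I) - Φ K σ (dg (W.insertIdx (i + 1) b) I)
      + (Φ K σ (dg (W.insertIdx j b) I) - Φ K σ (dg (W.insertIdx (j + 1) b) I)) = 0 := by
  wlog hlt : i < j generalizing i j
  · rw [add_comm]
    refine this hj hi (by rw [hij, σ.mate_mate]) (lt_of_le_of_ne (not_lt.1 hlt) ?_)
    rintro rfl
    exact σ.mate_ne _ hij.symm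
  obtain ⟨P, Q, R, hW, h1, h2⟩ := list_split_two hlt hj
  rw [hij] at hW
  generalize W[i] = y at hW h2
  have e1 : W.insertIdx i b = P ++ b :: y :: (Q ++ σ.mate y :: R) := by
    conv_lhs => rw [hW]
    rw [← h1, insertIdx_append_length]
  have e2 : W.insertIdx (i + 1) b = P ++ y :: b :: (Q ++ σ.mate y :: R) := by
    conv_lhs => rw [hW]
    have := insertIdx_append_length (P ++ [y]) (Q ++ σ.mate y :: R) b
    simpa [h1] using this
  have e3 : W.insertIdx j b = P ++ y :: (Q ++ b :: σ.mate y :: R) := by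
    conv_lhs => rw [hW]
    have := insertIdx_append_length (P ++ y :: Q) (σ.mate y :: R) b
    rw [h2] at this
    simpa using this
  have e4 : W.insertIdx (j + 1) b = P ++ y :: (Q ++ σ.mate y :: b :: R) := by
    conv_lhs => rw [hW]
    have := insertIdx_append_length (P ++ y :: Q ++ [σ.mate y]) R b
    rw [List.length_append, h2] at this
    simpa using this
  rw [e1, e2, e3, e4]
  have hv' : (dg (b :: y :: (Q ++ σ.mate y :: (R ++ P))) I).Valid σ n := by
    refine hv.perm (List.Perm.cons _ ?_)
    rw [hW]
    refine List.perm_append_comm.trans ?_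
    simp
  have := h.fourT hv' hq
  simp only [dg_append_comm P]
  simpa only [List.cons_append, List.append_assoc] using this

/-- Carry `b` from just after `a` all the way through `L` to just before `a`. The steps across the
two ends of each edge in `L` cancel by 4T, and all of `L` is paired within itself. -/
theorem IsSTU.swap_eq (h : IsSTU n q Φ) {L : List K} {a b : K} {I : Multiset (Cycle K)}
    (hv : (dg (a :: b :: L) I).Valid σ n) (hq : Multiset.card I < q)
    (hL : ∀ k ∈ L, σ.mate k ∈ L) :
    Φ K σ (dg (a :: b :: L) I) = Φ K σ (dg (b :: a :: L) I) := by
  have hv' : (dg (b :: a :: L) I).Valid σ n := hv.perm (List.Perm.swap _ _ _)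
  -- The index is shifted by one so that `b` starts behind `a` and never passes it.
  set f : ℕ → M := fun i => Φ K σ (dg ((a :: L).insertIdx (i + 1) b) I) with hf
  have hmate : ∀ i, i < L.length → ∃ j, ∃ hj : j < L.length, ∀ hi : i < L.length,
      L[j] = σ.mate L[i] := by
    intro i hi
    obtain ⟨j, hj, e⟩ := List.mem_iff_getElem.1 (hL L[i] (List.getElem_mem hi))
    exact ⟨j, hj, fun _ => e⟩
  choose! τ hτ hτ' using hmate
  have nd : L.Nodup := by
    have := hv.nodup
    simp only [supp_dg, Multiset.nodup_add, Multiset.coe_nodup, List.nodup_cons] at this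
    exact this.1.2.2
  have key : ∑ i ∈ Finset.range L.length, (f i - f (i + 1)) = 0 := by
    refine Finset.sum_involution (fun i _ => τ i) ?_ ?_ ?_ ?_
    · intro i hi
      have hi := Finset.mem_range.1 hi
      exact h.fourT_insertIdx (i := i + 1) (j := τ i + 1) hv' hq (by simpa using hi)
        (by simpa using hτ i hi) (by simpa using hτ' i hi hi)
    · intro i hi _ he
      have hi := Finset.mem_range.1 hi
      have := hτ' i hi hi
      simp only [he] at this
      exact σ.mate_ne _ this.symm
    · intro i hi
      exact Finset.mem_range.2 (hτ i (Finset.mem_range.1 hi))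
    · intro i hi
      have hi := Finset.mem_range.1 hi
      have h1 := hτ' _ (hτ i hi) (hτ i hi)
      rw [hτ' i hi hi, σ.mate_mate] at h1
      exact nd.getElem_inj_iff.1 h1
  rw [Finset.sum_range_sub', sub_eq_zero] at key
  have e0 : f 0 = Φ K σ (dg (a :: b :: L) I) := by simp [hf]
  have e1 : f L.length = Φ K σ (dg (b :: a :: L) I) := by
    simp only [hf, List.insertIdx_succ_cons, List.insertIdx_length_self]
    exact congrArg _ (dg_append_comm (a :: L) [b] I)
  rw [← e0, ← e1, key]

/-- STU at the only leg gives the two orders of two neighbouring ends in front of a list closed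
under pairing, and `IsSTU.swap_eq` identifies them. -/
theorem IsSTU.eq_zero (h : IsSTU n q Φ) {L : List K} {b : K} {I : Multiset (Cycle K)}
    {t : Cycle K} (hv : (dg (b :: L) I).Valid σ n) (hq : Multiset.card I ≤ q)
    (hL : ∀ k ∈ L, σ.mate k ∈ L) (ht : t ∈ I) (hb : σ.mate b ∈ t) :
    Φ K σ (dg (b :: L) I) = 0 := by
  obtain ⟨c, d, rfl⟩ := exists_tri_of_mem (hv.three t ht) hb
  obtain ⟨J, rfl⟩ := Multiset.exists_cons_of_mem ht
  rw [Multiset.card_cons] at hq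
  rw [h.stu hv (by omega), sub_eq_zero]
  exact h.swap_eq hv.resolve (by omega) hL

end

/-! ### Diagrams without internal vertices -/

section

variable {K K' : Type} {σ : Pairing K} {σ' : Pairing K'} {n : ℕ}

theorem ofFn_comp_finRotate {m : ℕ} (g : Fin m → K) (c : ℤ) :
    ((List.ofFn fun i => g ((finRotate m ^ c) i) : List K) : Cycle K) = (List.ofFn g : List K) := by
  have one : ∀ g : Fin m → K,
      ((List.ofFn fun i => g (finRotate m i) : List K) : Cycle K) = (List.ofFn g : List K) := by
    intro g
    cases m with
    | zero => simp
    | succ m =>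
      rw [List.ofFn_succ' (f := fun i => g (finRotate (m + 1) i)), List.ofFn_succ (f := g),
        List.concat_eq_append]
      simp only [finRotate_apply, Fin.coeSucc_eq_succ, Fin.last_add_one]
      exact Cycle.coe_eq_coe.2 (List.isRotated_append (l' := [g 0]))
  induction c using Int.induction_on with
  | zero => simp
  | succ c ih =>
    rw [← ih, ← one fun i => g ((finRotate m ^ (c : ℤ)) i)]
    simp [zpow_add_one]
  | pred c ih =>
    rw [← ih, ← one fun i => g ((finRotate m ^ (-(c : ℤ) - 1)) i)]
    simp only [← Equiv.Perm.mul_apply, ← zpow_add_one, sub_add_cancel]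

/-- Together with `ofFn_comp_finRotate`, this matches equality of cycles with rotation of
numberings, the equivalence that defines round diagrams. -/
theorem exists_finRotate {m : ℕ} {g g' : Fin m → K}
    (h : ((List.ofFn g : List K) : Cycle K) = (List.ofFn g' : List K)) :
    ∃ c : ℤ, ∀ i, g' i = g ((finRotate m ^ c) i) := by
  obtain ⟨k, hk⟩ := Cycle.coe_eq_coe.1 h
  have hrot : ∀ (k : ℕ) (i : Fin m), (((finRotate m) ^ k) i : ℕ) = (i + k) % m := by
    intro k
    induction k with
    | zero => intro i; simp [Nat.mod_eq_of_lt i.2]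
    | succ k ih =>
      intro i
      rw [pow_succ', Equiv.Perm.mul_apply]
      cases m with
      | zero => exact i.elim0
      | succ m =>
        rw [finRotate_apply, Fin.val_add, ih, Fin.val_one']
        simp [add_assoc]
  refine ⟨k, fun i => ?_⟩
  have hi : (i : ℕ) < ((List.ofFn g).rotate k).length := by simp
  have e := List.getElem_rotate (List.ofFn g) k i hi
  simp only [hk, List.getElem_ofFn, List.length_ofFn] at e
  rw [e]
  congr 1
  ext
  rw [zpow_natCast, hrot]

theorem exists_mate {X : Type} {g : X → K} (hg : Function.Injective g)
    (hc : ∀ x, ∃ y, g y = σ.mate (g x)) :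
    ∃ μ : Equiv.Perm X, (∀ x, μ (μ x) = x) ∧ (∀ x, μ x ≠ x) ∧ ∀ x, g (μ x) = σ.mate (g x) := by
  choose f hf using hc
  have hff : ∀ x, f (f x) = x := fun x => hg (by rw [hf, hf, σ.mate_mate])
  exact ⟨⟨f, f, hff, hff⟩, hff, fun x h => σ.mate_ne (g x) (by rw [← hf]; exact congrArg g h), hf⟩

/-- The based chord diagram `D` is presented by the cycle `c`. -/
structure IsRound (σ : Pairing K) (c : Cycle K) (D : BasedRound n) (g : Fin (2 * n) → K) :
    Prop where
  inj : Function.Injective g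
  map_mate : ∀ i, g (D.mate i) = σ.mate (g i)
  eq : c = ((List.ofFn g : List K) : Cycle K)

theorem IsRound.toRound_eq {c : Cycle K} {D D' : BasedRound n} {g g' : Fin (2 * n) → K}
    (h : IsRound σ c D g) (h' : IsRound σ c D' g') : D.toRound = D'.toRound := by
  obtain ⟨c, hc⟩ := exists_finRotate (h.eq.symm.trans h'.eq)
  refine (Quotient.sound (s := BasedRound.setoid n) ⟨c, fun x => h.inj ?_⟩).symm
  rw [← hc, h'.map_mate, h.map_mate, hc]

theorem IsRound.map {c : Cycle K} {D : BasedRound n} {g : Fin (2 * n) → K}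
    (h : IsRound σ c D g) (f : PairingEmb σ σ') : IsRound σ' (c.map f.toFun) D (f.toFun ∘ g) where
  inj := f.inj.comp h.inj
  map_mate i := by simp [h.map_mate, f.map_mate]
  eq := by simp [h.eq, List.map_ofFn]

theorem exists_isRound {L : List K} (nd : L.Nodup) (hc : ∀ k ∈ L, σ.mate k ∈ L)
    {g : Fin (2 * n) → K} (hg : List.ofFn g = L) :
    ∃ D : BasedRound n, IsRound σ (L : Cycle K) D g := by
  subst hg
  have hi := List.nodup_ofFn.1 nd
  obtain ⟨μ, h1, h2, h3⟩ := exists_mate (σ := σ) hi (fun x => by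
    have := hc (g x) (List.mem_ofFn.2 ⟨x, rfl⟩)
    exact List.mem_ofFn.1 this)
  exact ⟨⟨μ, h1, h2⟩, hi, h3, rfl⟩

theorem Diag.Valid.exists_isRound {L : List K} (h : (dg L 0).Valid σ n) {g : Fin (2 * n) → K}
    (hg : List.ofFn g = L) : ∃ D : BasedRound n, IsRound σ (L : Cycle K) D g :=
  ChordDiagrams.exists_isRound (by simpa using h.nodup) (by simpa using h.closed) hg

theorem exists_ofFn_eq {L : List K} {m : ℕ} (h : L.length = m) :
    ∃ g : Fin m → K, List.ofFn g = L := by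
  subst h
  exact ⟨L.get, List.ofFn_get L⟩

theorem Diag.Valid.exists_ofFn {L : List K} (h : (dg L 0).Valid σ n) :
    ∃ g : Fin (2 * n) → K, List.ofFn g = L := by
  have hl : L.length = 2 * n := by simpa using h.card
  exact exists_ofFn_eq hl

/-! ### Chord diagrams presented by cycles, and their 4T relation -/

variable (F : Type*) [Field F]

open Classical in
/-- The class of the chord diagram presented by a cycle. -/
noncomputable def roundClass (n : ℕ) (σ : Pairing K) (c : Cycle K) : RoundSpace F n :=
  if h : ∃ (D : BasedRound n) (g : Fin (2 * n) → K), IsRound σ c D g then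
    h.choose.toRound.toSpace F else 0

theorem IsRound.roundClass_eq {c : Cycle K} {D : BasedRound n} {g : Fin (2 * n) → K}
    (h : IsRound σ c D g) : roundClass F n σ c = D.toRound.toSpace F := by
  have hex : ∃ (D : BasedRound n) (g : Fin (2 * n) → K), IsRound σ c D g := ⟨D, g, h⟩
  rw [roundClass, dif_pos hex]
  exact congrArg _ (hex.choose_spec.choose_spec.toRound_eq h)

theorem Diag.Valid.roundClass_map {L : List K} (h : (dg L 0).Valid σ n) (f : PairingEmb σ σ') :
    roundClass F n σ' ((L.map f.toFun : List K') : Cycle K') = roundClass F n σ (L : Cycle K) := by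
  obtain ⟨g, hg⟩ := h.exists_ofFn
  obtain ⟨D, hD⟩ := h.exists_isRound hg
  rw [hD.roundClass_eq F, ← Cycle.map_coe, (hD.map f).roundClass_eq F]

theorem ofFn_insertNth {m : ℕ} (p : Fin (m + 1)) (b : K) (w : Fin m → K) :
    List.ofFn (p.insertNth b w : Fin (m + 1) → K) = (List.ofFn w).insertIdx p b := by
  have hp : (p : ℕ) ≤ m := Nat.lt_succ_iff.1 p.2
  refine List.ext_getElem (by simp [List.length_insertIdx, hp]) fun i h1 h2 => ?_
  have hi : i < m + 1 := by simpa using h1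
  rw [List.getElem_ofFn, List.getElem_insertIdx]
  obtain ⟨q, rfl⟩ : ∃ q : Fin (m + 1), (q : ℕ) = i := ⟨⟨i, hi⟩, rfl⟩
  rcases Fin.eq_self_or_eq_succAbove p q with rfl | ⟨y, rfl⟩
  · simp
  · rcases lt_or_ge y.castSucc p with hlt | hge
    · have e := Fin.succAbove_of_castSucc_lt p y hlt
      have : (y : ℕ) < p := hlt
      simp only [Fin.eta, Fin.insertNth_apply_succAbove]
      simp [e, this]
    · have e := Fin.succAbove_of_le_castSucc p y hge
      have : (p : ℕ) ≤ y := hge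
      have h3 : ¬ (y : ℕ) + 1 < p := by omega
      have h4 : ¬ (y : ℕ) + 1 = p := by omega
      simp only [Fin.eta, Fin.insertNth_apply_succAbove]
      simp [e, h3, h4]

theorem roundClass_fourT_insertIdx {W : List K} {b : K} (hv : (dg (b :: W) 0).Valid σ n) {i j : ℕ}
    (hi : i < W.length) (hj : j < W.length) (hij : W[j] = σ.mate W[i]) (hb : W[i] ≠ σ.mate b) :
    roundClass F n σ (W.insertIdx i b : List K) - roundClass F n σ (W.insertIdx (i + 1) b : List K)
      + (roundClass F n σ (W.insertIdx j b : List K)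
        - roundClass F n σ (W.insertIdx (j + 1) b : List K)) = 0 := by
  have hl : W.length + 1 = 2 * n := by simpa using hv.card
  obtain ⟨k, rfl⟩ : ∃ k, n = k + 1 := ⟨n - 1, by omega⟩
  obtain ⟨w, rfl⟩ : ∃ w : Fin (2 * k + 1) → K, List.ofFn w = W := by
    exact exists_ofFn_eq (by omega)
  have hins : ∀ p : Fin (2 * k + 1 + 1), ∃ D : BasedRound (k + 1),
      IsRound σ (((List.ofFn w).insertIdx p b : List K) : Cycle K) D (p.insertNth b w) := by
    intro p
    have hp : (p : ℕ) ≤ (List.ofFn w).length := by simpa using Nat.lt_succ_iff.1 p.2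
    exact (hv.perm (List.perm_insertIdx b _ hp).symm).exists_isRound (ofFn_insertNth p b w)
  choose D hD using hins
  have nd := hv.nodup
  simp only [supp_dg, Multiset.zero_bind, add_zero, Multiset.coe_nodup, List.nodup_cons] at nd
  have hw := List.nodup_ofFn.1 nd.2
  have hcl : ∀ k ∈ b :: List.ofFn w, σ.mate k ∈ b :: List.ofFn w := by simpa using hv.closed
  obtain ⟨z, hz⟩ : ∃ z, w z = σ.mate b := by
    have := hcl b (by simp)
    rw [List.mem_cons] at this
    exact List.mem_ofFn.1 (this.resolve_left (σ.mate_ne b))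
  -- With `b` removed, its partner `z` has no mate left; the relators expect an involution whose
  -- only fixed point is `z`.
  have hτ : ∀ y, ∃ y', (y = z → y' = z) ∧ (y ≠ z → w y' = σ.mate (w y)) := by
    intro y
    by_cases hy : y = z
    · exact ⟨z, fun _ => rfl, fun h => absurd hy h⟩
    · have := hcl (w y) (List.mem_cons_of_mem _ (List.mem_ofFn.2 ⟨y, rfl⟩))
      rw [List.mem_cons] at this
      rcases this with h | h
      · refine absurd (hw ?_) hy
        rw [hz, ← h, σ.mate_mate]
      · obtain ⟨y', hy'⟩ := List.mem_ofFn.1 h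
        exact ⟨y', fun h => absurd h hy, fun _ => hy'⟩
  choose τ hτ1 hτ2 using hτ
  have hτz : τ z = z := hτ1 z rfl
  have hne : ∀ y, y ≠ z → τ y ≠ z := by
    intro y hy h
    have := hτ2 y hy
    rw [h, hz, σ.mate_inj] at this
    exact nd.1 (this ▸ List.mem_ofFn.2 ⟨y, rfl⟩)
  have hττ : ∀ y, τ (τ y) = y := by
    intro y
    by_cases hy : y = z
    · rw [hy, hτz, hτz]
    · exact hw (by rw [hτ2 _ (hne y hy), hτ2 y hy, σ.mate_mate])
  have hfix : ∀ y, τ y = y ↔ y = z := by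
    refine fun y => ⟨fun h => ?_, fun h => h ▸ hτz⟩
    by_contra hy
    have := hτ2 y hy
    rw [h] at this
    exact σ.mate_ne _ this.symm
  have hI : ∀ p, IsInsertion ⟨τ, τ, hττ, hττ⟩ z p (D p) := by
    intro p
    refine ⟨(hD p).inj ?_, fun y hy => (hD p).inj ?_⟩
    · rw [(hD p).map_mate]
      simp [hz]
    · rw [(hD p).map_mate]
      simpa using (hτ2 y hy).symm
  have hi' : i < 2 * k + 1 := by simpa using hi
  have hj' : j < 2 * k + 1 := by simpa using hj
  set x : Fin (2 * k + 1) := ⟨i, hi'⟩ with hx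
  have hxz : x ≠ z := by
    rintro rfl
    exact hb (by rwa [List.getElem_ofFn])
  have hjx : τ x = ⟨j, hj'⟩ := hw (by
    rw [List.getElem_ofFn, List.getElem_ofFn] at hij
    rw [hτ2 x hxz, hij])
  have c1 := (hD x.castSucc).roundClass_eq F
  have c2 := (hD (τ x).castSucc).roundClass_eq F
  have c3 := (hD x.succ).roundClass_eq F
  have c4 := (hD (τ x).succ).roundClass_eq F
  have v1 : ((x.castSucc : Fin (2 * k + 1 + 1)) : ℕ) = i := rfl
  have v2 : (((τ x).castSucc : Fin (2 * k + 1 + 1)) : ℕ) = j := by rw [hjx]; rfl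
  have v3 : ((x.succ : Fin (2 * k + 1 + 1)) : ℕ) = i + 1 := rfl
  have v4 : (((τ x).succ : Fin (2 * k + 1 + 1)) : ℕ) = j + 1 := by rw [hjx]; rfl
  rw [v1] at c1
  rw [v2] at c2
  rw [v3] at c3
  rw [v4] at c4
  rw [c1, c2, c3, c4]
  have key : (Finsupp.single (D x.castSucc).toRound 1 + Finsupp.single (D (τ x).castSucc).toRound 1
      - (Finsupp.single (D x.succ).toRound 1 + Finsupp.single (D (τ x).succ).toRound (1 : F))) ∈
      Submodule.span F (roundFourTermRelators F (k + 1)) :=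
    Submodule.subset_span ⟨⟨τ, τ, hττ, hττ⟩, z, x, _, _, _, _, hττ, hfix, hxz, hI _, hI _, hI _,
      hI _, rfl⟩
  have key' := (Submodule.Quotient.mk_eq_zero _).2 key
  simp only [Submodule.Quotient.mk_sub, Submodule.Quotient.mk_add] at key'
  simp only [RoundDiagram.toSpace]
  rw [← key']
  abel

theorem roundClass_fourT {y b : K} {P Q R : List K}
    (hv : (dg (P ++ b :: y :: (Q ++ σ.mate y :: R)) 0).Valid σ n) (hb : y ≠ σ.mate b) :
    roundClass F n σ (P ++ b :: y :: (Q ++ σ.mate y :: R) : List K)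
      - roundClass F n σ (P ++ y :: b :: (Q ++ σ.mate y :: R) : List K)
      + (roundClass F n σ (P ++ y :: (Q ++ b :: σ.mate y :: R) : List K)
        - roundClass F n σ (P ++ y :: (Q ++ σ.mate y :: b :: R) : List K)) = 0 := by
  have hv' : (dg (b :: (P ++ y :: (Q ++ σ.mate y :: R))) 0).Valid σ n :=
    hv.perm List.perm_middle
  have := roundClass_fourT_insertIdx F hv' (i := P.length) (j := P.length + 1 + Q.length)
    (by simp) (by simp; omega) ?_ (by simpa using hb)
  · have e1 := insertIdx_append_length P (y :: (Q ++ σ.mate y :: R)) b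
    have e2 := insertIdx_append_length (P ++ [y]) (Q ++ σ.mate y :: R) b
    have e3 := insertIdx_append_length (P ++ y :: Q) (σ.mate y :: R) b
    have e4 := insertIdx_append_length (P ++ y :: Q ++ [σ.mate y]) R b
    simp only [List.length_append, List.length_cons, List.length_nil, List.append_assoc,
      List.cons_append, List.nil_append, zero_add] at e1 e2 e3 e4
    have a1 : P.length + 1 + Q.length = P.length + (Q.length + 1) := by omega
    have a2 : P.length + 1 + Q.length + 1 = P.length + (Q.length + 1 + 1) := by omega
    rw [e1, e2, a2, a1] at this
    rw [e3] at this
    rw [show P.length + (Q.length + 1 + 1) = P.length + (Q.length + 1) + 1 by omega] at this e4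
    rwa [e4] at this
  · have : ∀ A B : List K, ∀ u, ∀ i (h : i < (A ++ u :: B).length), i = A.length →
        (A ++ u :: B)[i] = u := by
      rintro A B u i h rfl
      simp
    have e : P ++ y :: (Q ++ σ.mate y :: R) = (P ++ y :: Q) ++ σ.mate y :: R := by simp
    simp only [e]
    rw [this _ _ _ _ _ (by simp; omega)]
    simp

end

/-! ### From Jacobi diagrams to round chord diagrams -/

section

variable {K : Type} {σ : Pairing K} {n q : ℕ}

theorem tri_disjoint {L : List K} {t t' : Cycle K} {J : Multiset (Cycle K)}
    (hv : (dg L (t ::ₘ t' ::ₘ J)).Valid σ n) {k : K} (hk : k ∈ t) : k ∉ t' := by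
  have nd := hv.nodup
  rw [supp_dg, Multiset.cons_bind, Multiset.nodup_add, Multiset.nodup_add, Multiset.cons_bind,
    Multiset.disjoint_add_right] at nd
  intro hk'
  exact Multiset.disjoint_left.1 nd.2.1.2.2.1 (mem_toMultiset.2 hk) (mem_toMultiset.2 hk')

theorem circ_disjoint {L : List K} {t : Cycle K} {I : Multiset (Cycle K)}
    (hv : (dg L I).Valid σ n) (ht : t ∈ I) {k : K} (hk : k ∈ L) : k ∉ t := by
  have nd := hv.nodup
  rw [supp_dg, Multiset.nodup_add] at nd
  intro hk'
  exact Multiset.disjoint_left.1 nd.2.2 (Multiset.mem_coe.2 hk)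
    (Multiset.mem_bind.2 ⟨t, ht, mem_toMultiset.2 hk'⟩)

theorem Diag.Valid.nodup_circ {L : List K} {I : Multiset (Cycle K)}
    (hv : (dg L I).Valid σ n) : L.Nodup := by
  have nd := hv.nodup
  rw [supp_dg, Multiset.nodup_add] at nd
  exact nd.1

theorem Diag.Valid.nodup_tri {L : List K} {I : Multiset (Cycle K)} {a b c : K}
    (hv : (dg L (tri a b c ::ₘ I)).Valid σ n) : [a, b, c].Nodup := by
  have nd := hv.nodup
  rw [supp_dg, Multiset.cons_bind, Multiset.nodup_add, Multiset.nodup_add] at nd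
  exact nd.2.1.1

theorem mem_supp_dg {L : List K} {I : Multiset (Cycle K)} {k : K} :
    k ∈ (dg L I).supp ↔ k ∈ L ∨ ∃ t ∈ I, k ∈ t := by
  rw [Diag.mem_supp]
  simp

variable {M : Type*} [AddCommGroup M]

/-- The right hand side of the STU relation. -/
def stuDiff (Φ : ∀ K : Type, Pairing K → Diag K → M) (σ : Pairing K) (L : List K) (a b : K)
    (I : Multiset (Cycle K)) : M :=
  Φ K σ (dg (b :: a :: L) I) - Φ K σ (dg (a :: b :: L) I)

variable {Φ : ∀ K : Type, Pairing K → Diag K → M}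

/-- Legs at distinct vertices survive each other's resolution, so applying STU at the remaining leg
expands both sides into the same four diagrams. -/
theorem IsSTU.stuDiff_comm (h : IsSTU n q Φ) {x y a b c d : K} {A B : List K}
    {J : Multiset (Cycle K)}
    (hv : (dg (x :: (A ++ y :: B)) (tri (σ.mate x) a b ::ₘ tri (σ.mate y) c d ::ₘ J)).Valid σ n)
    (hq : Multiset.card J < q) :
    stuDiff Φ σ (A ++ y :: B) a b (tri (σ.mate y) c d ::ₘ J) =
      stuDiff Φ σ (B ++ x :: A) c d (tri (σ.mate x) a b ::ₘ J) := by
  have rot : ∀ (u v y : K) (A B : List K) (I : Multiset (Cycle K)),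
      dg (u :: v :: (A ++ y :: B)) I = dg (y :: (B ++ u :: v :: A)) I := by
    intro u v y A B I
    exact dg_append_comm (u :: v :: A) (y :: B) I
  have rot2 : ∀ (p r u v : K) (A B : List K) (I : Multiset (Cycle K)),
      dg (p :: r :: (B ++ u :: v :: A)) I = dg (u :: v :: (A ++ p :: r :: B)) I := by
    intro p r u v A B I
    exact dg_append_comm (p :: r :: B) (u :: v :: A) I
  have hv' : (dg (y :: (B ++ x :: A))
      (tri (σ.mate y) c d ::ₘ tri (σ.mate x) a b ::ₘ J)).Valid σ n := by
    rw [Multiset.cons_swap]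
    exact hv.perm (List.perm_append_comm (l₁ := x :: A) (l₂ := y :: B))
  have h1 := hv.resolve
  have h2 := h1.perm (List.Perm.swap _ _ _)
  have h3 := hv'.resolve
  have h4 := h3.perm (List.Perm.swap _ _ _)
  rw [rot] at h1 h2 h3 h4
  simp only [stuDiff, rot, h.stu h1 hq, h.stu h2 hq, h.stu h3 hq, h.stu h4 hq]
  simp only [rot2 _ _ _ _ A B, ← rot]
  abel

theorem IsSTU.stuDiff_eq_of_ne (h : IsSTU n q Φ) {x y a b c d : K} {L L' : List K}
    {I I' : Multiset (Cycle K)} (hv : (dg (x :: L) (tri (σ.mate x) a b ::ₘ I)).Valid σ n)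
    (hq : Multiset.card I ≤ q)
    (e : dg (x :: L) (tri (σ.mate x) a b ::ₘ I) = dg (y :: L') (tri (σ.mate y) c d ::ₘ I'))
    (hne : tri (σ.mate x) a b ≠ tri (σ.mate y) c d) :
    stuDiff Φ σ L a b I = stuDiff Φ σ L' c d I' := by
  obtain ⟨-, J, rfl, rfl⟩ := (Multiset.cons_eq_cons.1 (congrArg Diag.ints e)).resolve_left
    fun h => hne h.1
  have hy : y ∈ x :: L := by
    have : y ∈ (dg (x :: L) (tri (σ.mate x) a b ::ₘ tri (σ.mate y) c d ::ₘ J)).circ := by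
      rw [e]
      simp
    simpa using this
  rcases List.mem_cons.1 hy with rfl | hy
  · exact absurd (by simp) (tri_disjoint hv (k := σ.mate y) (by simp))
  · obtain ⟨A, B, rfl⟩ := List.append_of_mem hy
    have nd : (y :: (B ++ x :: A)).Nodup :=
      (List.perm_append_comm (l₁ := x :: A) (l₂ := y :: B)).nodup_iff.1 hv.nodup_circ
    have e2 : dg (x :: (A ++ y :: B)) (tri (σ.mate x) a b ::ₘ tri (σ.mate y) c d ::ₘ J) =
        dg (y :: (B ++ x :: A)) (tri (σ.mate x) a b ::ₘ tri (σ.mate y) c d ::ₘ J) :=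
      dg_append_comm (x :: A) (y :: B) _
    rw [e2] at e
    obtain ⟨rfl, -⟩ := dg_cons_inj nd e
    rw [Multiset.card_cons] at hq
    exact h.stuDiff_comm hv (by omega)

/-- When no other end on the circle leads to an internal vertex, the remaining ends must be joined
among themselves, as `IsSTU.eq_zero` requires. -/
theorem IsSTU.eq_zero_of_single_leg (h : IsSTU n q Φ) {L : List K} {b : K}
    {I : Multiset (Cycle K)} {t : Cycle K} (hv : (dg (b :: L) I).Valid σ n)
    (hq : Multiset.card I ≤ q) (ht : t ∈ I) (hb : σ.mate b ∈ t)
    (hL : ∀ k ∈ L, ∀ t ∈ I, σ.mate k ∉ t) : Φ K σ (dg (b :: L) I) = 0 := by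
  refine h.eq_zero hv hq (fun k hk => ?_) ht hb
  have := hv.closed k (mem_supp_dg.2 (Or.inl (List.mem_cons_of_mem _ hk)))
  rcases mem_supp_dg.1 this with h1 | ⟨t', ht', hkt⟩
  · rcases List.mem_cons.1 h1 with h1 | h1
    · rw [← h1, σ.mate_mate] at hb
      exact absurd hb (circ_disjoint hv ht (List.mem_cons_of_mem _ hk))
    · exact h1
  · exact absurd hkt (hL k hk t' ht')

/-! ### Resolution of all internal vertices and its independence of choices -/

variable (F : Type*) [Field F]

open Classical in
/-- The combination of chord diagrams obtained by removing the internal vertices one by one. -/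
noncomputable def resolveAux (n : ℕ) : ℕ → ∀ K : Type, Pairing K → Diag K → RoundSpace F n
  | 0, _, σ, D => roundClass F n σ D.circ
  | q + 1, K, σ, D =>
    if h : ∃ p : K × List K × K × K × Multiset (Cycle K),
      D = dg (p.1 :: p.2.1) (tri (σ.mate p.1) p.2.2.1 p.2.2.2.1 ::ₘ p.2.2.2.2) then
      stuDiff (resolveAux n q) σ h.choose.2.1 h.choose.2.2.1 h.choose.2.2.2.1 h.choose.2.2.2.2
    else 0

/-- The combination of chord diagrams represented by a diagram with internal vertices. -/
noncomputable def resolved (n : ℕ) (K : Type) (σ : Pairing K) (D : Diag K) : RoundSpace F n :=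
  resolveAux F n (Multiset.card D.ints) K σ D

theorem resolved_zero (L : List K) :
    resolved F n K σ (dg L 0) = roundClass F n σ (L : Cycle K) := rfl

/-- Resolving the only vertex at `x` or at `y` slides the end `b` past one or the other end of the
same chord, so 4T equates the results. What remains is to identify the names: that chord is `σ.mate
y, y` on one side and `x, σ.mate x` on the other. -/
theorem stuDiff_tripod {x y b : K} {A B : List K}
    (hv : (dg (x :: (A ++ y :: B)) (tri (σ.mate x) (σ.mate y) b ::ₘ 0)).Valid σ n)
    (hb : σ.mate b ∈ A ++ B) :
    stuDiff (resolved F n) σ (A ++ y :: B) (σ.mate y) b 0 =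
      stuDiff (resolved F n) σ (B ++ x :: A) b (σ.mate x) 0 := by
  classical
  have hv1 := hv.resolve
  have hp : (dg (y :: (B ++ x :: A)) (tri (σ.mate y) b (σ.mate x) ::ₘ 0)).Valid σ n := by
    rw [← tri_rotate]
    exact hv.perm (List.perm_append_comm (l₁ := x :: A) (l₂ := y :: B))
  have nd := hv1.nodup_circ
  have nd2 := hv.nodup_circ
  have hby : σ.mate y ≠ σ.mate b := by
    rw [Ne, σ.mate_inj]
    rintro rfl
    simp at nd
  have four := roundClass_fourT F (P := []) (y := σ.mate y) (b := b) (Q := A) (R := B)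
    (by simpa [σ.mate_mate] using hv1) hby
  rw [σ.mate_mate, List.nil_append, List.nil_append, List.nil_append, List.nil_append] at four
  have hsymm : ∀ k, σ.mate k = y ↔ k = σ.mate y := fun k => by
    rw [← σ.mate_inj, σ.mate_mate]
  have hsymm2 : ∀ k, σ.mate k = x ↔ k = σ.mate x := fun k => by
    rw [← σ.mate_inj, σ.mate_mate]
  have hxy : x ≠ y := by
    rintro rfl
    simp at nd2
  have hxA : x ∉ A := by simp at nd2; tauto
  have hxB : x ∉ B := by simp at nd2; tauto
  have hyA : y ∉ A := by
    intro h
    simp only [List.nodup_cons, List.nodup_append] at nd2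
    exact nd2.2.2.2 y h y (by simp) rfl
  have hyB : y ∉ B := by
    intro h
    simp only [List.nodup_cons, List.nodup_append] at nd2
    exact nd2.2.2.1.1 h
  have ndt := hv.nodup_tri
  have htd : ∀ k ∈ x :: (A ++ y :: B), k ∉ tri (σ.mate x) (σ.mate y) b := fun k hk =>
    circ_disjoint hv (Multiset.mem_cons_self _ _) hk
  have hAB : ∀ k ∈ A ++ B, k ≠ σ.mate x ∧ k ≠ σ.mate y := by
    intro k hk
    have := htd k (by simp only [List.mem_cons, List.mem_append] at hk ⊢; tauto)
    simp only [mem_tri] at this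
    tauto
  have hbx : b ≠ x := by
    rintro rfl
    exact htd b (by simp) (by simp)
  have hby2 : b ≠ y := by
    rintro rfl
    exact htd b (by simp) (by simp)
  simp only [List.nodup_cons, List.mem_cons, not_or] at ndt
  -- This renaming exchanges `σ.mate y` with `x` and `y` with `σ.mate x`. It respects the pairing
  -- and carries the chord left by one resolution to the chord left by the other.
  let τ : Equiv.Perm K := (Equiv.swap (σ.mate y) x).trans (Equiv.swap y (σ.mate x))
  have hyx : y ≠ σ.mate x := by
    intro e
    refine htd y (by simp) ?_
    simp [e]
  have hxy' : x ≠ σ.mate y := by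
    intro e
    exact hyx (by rw [e, σ.mate_mate])
  have t1 : τ (σ.mate y) = x := by
    simp only [τ, Equiv.trans_apply, Equiv.swap_apply_left]
    exact Equiv.swap_apply_of_ne_of_ne hxy (σ.mate_ne x).symm
  have t2 : τ y = σ.mate x := by
    simp only [τ, Equiv.trans_apply]
    rw [Equiv.swap_apply_of_ne_of_ne (σ.mate_ne y).symm hxy.symm, Equiv.swap_apply_left]
  have t3 : τ x = σ.mate y := by
    simp only [τ, Equiv.trans_apply, Equiv.swap_apply_right]
    exact Equiv.swap_apply_of_ne_of_ne (σ.mate_ne y) (fun h => hxy (σ.mate_inj.1 h).symm)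
  have t4 : τ (σ.mate x) = y := by
    simp only [τ, Equiv.trans_apply]
    rw [Equiv.swap_apply_of_ne_of_ne (fun h => hxy (σ.mate_inj.1 h)) (σ.mate_ne x),
      Equiv.swap_apply_right]
  have t5 : ∀ k, k ≠ x → k ≠ y → k ≠ σ.mate x → k ≠ σ.mate y → τ k = k := by
    intro k h1 h2 h3 h4
    simp only [τ, Equiv.trans_apply]
    rw [Equiv.swap_apply_of_ne_of_ne h4 h1, Equiv.swap_apply_of_ne_of_ne h2 h3]
  let f : PairingEmb σ σ := ⟨τ, τ.injective, fun k => by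
    by_cases h1 : k = x
    · rw [h1, t4, t3, σ.mate_mate]
    by_cases h2 : k = y
    · rw [h2, t1, t2, σ.mate_mate]
    by_cases h3 : k = σ.mate x
    · rw [h3, σ.mate_mate, t3, t4]
    by_cases h4 : k = σ.mate y
    · rw [h4, σ.mate_mate, t2, t1]
    rw [t5 k h1 h2 h3 h4, t5]
    · rwa [Ne, hsymm2]
    · rwa [Ne, hsymm]
    · rwa [Ne, σ.mate_inj]
    · rwa [Ne, σ.mate_inj]⟩
  have hfL : ∀ C : List K, (∀ k ∈ C, k ∈ A ++ B) → C.map f.toFun = C := by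
    intro C hC
    refine (List.map_congr_left fun k hk => ?_).trans (List.map_id C)
    have h1 := hAB k (hC k hk)
    have h2 := hC k hk
    refine t5 k ?_ ?_ h1.1 h1.2
    · rintro rfl
      rw [List.mem_append] at h2
      tauto
    · rintro rfl
      rw [List.mem_append] at h2
      tauto
  have fA := hfL A fun k hk => List.mem_append_left _ hk
  have fB := hfL B fun k hk => List.mem_append_right _ hk
  have fb : f.toFun b = b := t5 b hbx hby2 (fun h => ndt.1.2.1 h.symm) (fun h => ndt.2.1.1 h.symm)
  have hv2 : (dg (σ.mate y :: (A ++ b :: y :: B)) 0).Valid σ n := by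
    refine hv1.perm ?_
    refine (List.Perm.swap _ _ _).trans (List.Perm.cons _ ?_)
    exact List.perm_middle.symm
  have hv3 : (dg (σ.mate y :: (A ++ y :: b :: B)) 0).Valid σ n :=
    hv2.perm (List.Perm.cons _ (List.Perm.append_left _ (List.Perm.swap _ _ _)))
  have m2 := hv2.roundClass_map F f
  have m3 := hv3.roundClass_map F f
  have f1 : f.toFun (σ.mate y) = x := t1
  have f2 : f.toFun y = σ.mate x := t2
  simp only [List.map_cons, List.map_append, fA, fB, fb, f1, f2] at m2 m3
  have rot : ∀ (p r : K), ((x :: (A ++ p :: r :: B) : List K) : Cycle K) =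
      (p :: r :: (B ++ x :: A) : List K) := fun p r =>
    Cycle.coe_eq_coe.2 (List.isRotated_append (l := x :: A) (l' := p :: r :: B))
  rw [rot] at m2 m3
  simp only [stuDiff, resolved_zero]
  rw [m2, m3]
  rw [← sub_eq_zero, ← four]
  abel

/-- The critical case of two legs at one vertex. The cases are a leg at another vertex, a third edge
ending on the circle, and a third edge ending at another internal vertex. -/
theorem stuDiff_same (h : IsSTU n q (resolved F n)) {x y b : K} {A B : List K}
    {I : Multiset (Cycle K)}
    (hv : (dg (x :: (A ++ y :: B)) (tri (σ.mate x) (σ.mate y) b ::ₘ I)).Valid σ n)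
    (hq : Multiset.card I ≤ q) :
    stuDiff (resolved F n) σ (A ++ y :: B) (σ.mate y) b I =
      stuDiff (resolved F n) σ (B ++ x :: A) b (σ.mate x) I := by
  have rot : dg (x :: (A ++ y :: B)) (tri (σ.mate x) (σ.mate y) b ::ₘ I) =
      dg (y :: (B ++ x :: A)) (tri (σ.mate y) b (σ.mate x) ::ₘ I) := by
    rw [tri_rotate]
    exact dg_append_comm (x :: A) (y :: B) _
  by_cases hex : ∃ z t, z ∈ x :: (A ++ y :: B) ∧ t ∈ I ∧ σ.mate z ∈ t
  · obtain ⟨z, t, hz, ht, hzt⟩ := hex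
    obtain ⟨L, c, d, J, e, rfl⟩ := exists_leg_of_mem (σ := σ) hv.three (x := z) (t := t)
      (by simpa using hz) (by simp [ht]) hzt
    have hne : tri (σ.mate x) (σ.mate y) b ≠ tri (σ.mate z) c d := by
      intro e'
      obtain ⟨J', rfl⟩ := Multiset.exists_cons_of_mem ht
      exact tri_disjoint hv (k := σ.mate x) (by simp) (e' ▸ by simp)
    have hv' := rot ▸ hv
    have e2 := rot.symm.trans e
    -- Both resolutions agree with the one at the leg `z`, which belongs to a different vertex.
    rw [h.stuDiff_eq_of_ne hv hq e hne, h.stuDiff_eq_of_ne hv' hq e2 (by rwa [← tri_rotate])]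
  · push Not at hex
    have hbs : σ.mate b ∈ (dg (x :: (A ++ y :: B)) (tri (σ.mate x) (σ.mate y) b ::ₘ I)).supp :=
      hv.closed b (mem_supp_dg.2 (Or.inr ⟨_, Multiset.mem_cons_self _ _, by simp⟩))
    have htd : ∀ k ∈ x :: (A ++ y :: B), k ∉ tri (σ.mate x) (σ.mate y) b := fun k hk =>
      circ_disjoint hv (Multiset.mem_cons_self _ _) hk
    have ndt := hv.nodup_tri
    have hbx : b ≠ x := by
      rintro rfl
      exact htd b (by simp) (by simp)
    have hby : b ≠ y := by
      rintro rfl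
      exact htd b (by simp) (by simp)
    have hv1 := hv.resolve
    have hv2 := hv1.perm (List.Perm.swap _ _ _)
    have hvr := (rot ▸ hv).resolve
    have hvr2 := hvr.perm (List.Perm.swap _ _ _)
    rw [mem_supp_dg] at hbs
    rcases hbs with hbs | ⟨t, ht, hbt⟩
    -- If internal vertices remained, the resolved diagram would have a leg, but its ends `b` and
    -- `σ.mate y` lead to the circle and the other ends are excluded by `hex`.
    · have hI : I = 0 := by
        by_contra hI
        obtain ⟨z, t, hz, ht, hzt⟩ := hv1.exists_mem hI
        have hz' : z = b ∨ z = σ.mate y ∨ z ∈ A ++ y :: B := by simpa using hz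
        rcases hz' with rfl | rfl | hz'
        · exact circ_disjoint hv (Multiset.mem_cons_of_mem ht) hbs hzt
        · rw [σ.mate_mate] at hzt
          exact circ_disjoint hv (Multiset.mem_cons_of_mem ht) (by simp) hzt
        · exact hex z t (List.mem_cons_of_mem _ hz') ht hzt
      subst hI
      refine stuDiff_tripod F hv ?_
      have h1 : σ.mate b ≠ x := by
        rintro rfl
        rw [σ.mate_mate] at ndt
        simp at ndt
      have h2 : σ.mate b ≠ y := by
        rintro rfl
        rw [σ.mate_mate] at ndt
        simp at ndt
      simp only [List.mem_cons, List.mem_append] at hbs ⊢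
      tauto
    · rw [Multiset.mem_cons] at ht
      rcases ht with rfl | ht
      · simp only [mem_tri, σ.mate_inj, hbx, hby, σ.mate_ne, or_self] at hbt
      -- Here `b` becomes the only leg of each resolved diagram, so all four terms vanish.
      · have hno : ∀ z, z = σ.mate x ∨ z = σ.mate y ∨ z ∈ x :: (A ++ y :: B) →
            ∀ t ∈ I, σ.mate z ∉ t := by
          rintro z (rfl | rfl | hz) t ht
          · rw [σ.mate_mate]
            exact circ_disjoint hv (Multiset.mem_cons_of_mem ht) (by simp)
          · rw [σ.mate_mate]
            exact circ_disjoint hv (Multiset.mem_cons_of_mem ht) (by simp)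
          · exact hex z t hz ht
        have rot2 : ∀ (a : K) (L : List K), dg (a :: b :: L) I = dg (b :: (L ++ [a])) I :=
          fun a L => dg_append_comm [a] (b :: L) I
        rw [rot2] at hv2 hvr
        simp only [stuDiff, rot2]
        rw [h.eq_zero_of_single_leg hv1 hq ht hbt, h.eq_zero_of_single_leg hv2 hq ht hbt,
          h.eq_zero_of_single_leg hvr hq ht hbt, h.eq_zero_of_single_leg hvr2 hq ht hbt]
        all_goals
          intro k hk
          refine hno k ?_
          simp only [List.mem_cons, List.mem_append, List.mem_nil_iff, or_false] at hk ⊢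
          tauto

theorem stuDiff_eq (h : IsSTU n q (resolved F n)) {x y a b c d : K} {L L' : List K}
    {I I' : Multiset (Cycle K)} (hv : (dg (x :: L) (tri (σ.mate x) a b ::ₘ I)).Valid σ n)
    (hq : Multiset.card I ≤ q)
    (e : dg (x :: L) (tri (σ.mate x) a b ::ₘ I) = dg (y :: L') (tri (σ.mate y) c d ::ₘ I')) :
    stuDiff (resolved F n) σ L a b I = stuDiff (resolved F n) σ L' c d I' := by
  by_cases hne : tri (σ.mate x) a b = tri (σ.mate y) c d
  swap
  · exact h.stuDiff_eq_of_ne hv hq e hne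
  have hI : I = I' := by
    have := congrArg Diag.ints e
    rw [dg_ints, dg_ints, hne] at this
    exact (Multiset.cons_inj_right _).1 this
  subst hI
  have hv' := e ▸ hv
  have ndt := hv.nodup_tri
  have ndt' := hv'.nodup_tri
  have hy : y ∈ x :: L := by
    have : y ∈ (dg (x :: L) (tri (σ.mate x) a b ::ₘ I)).circ := by
      rw [e]
      simp
    simpa using this
  rcases List.mem_cons.1 hy with rfl | hyL
  · obtain ⟨rfl, rfl⟩ := tri_inj ndt hne
    obtain ⟨rfl, -⟩ := dg_cons_inj hv.nodup_circ e
    rfl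
  obtain ⟨A, B, rfl⟩ := List.append_of_mem hyL
  have nd : (y :: (B ++ x :: A)).Nodup :=
    (List.perm_append_comm (l₁ := x :: A) (l₂ := y :: B)).nodup_iff.1 hv.nodup_circ
  have e2 : dg (x :: (A ++ y :: B)) (tri (σ.mate x) a b ::ₘ I) =
      dg (y :: (B ++ x :: A)) (tri (σ.mate x) a b ::ₘ I) :=
    dg_append_comm (x :: A) (y :: B) _
  obtain ⟨rfl, -⟩ := dg_cons_inj nd (e2.symm.trans e)
  have hmem : σ.mate y ∈ tri (σ.mate x) a b := by
    rw [hne]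
    simp
  rcases mem_tri.1 hmem with h1 | rfl | rfl
  · rw [σ.mate_inj] at h1
    subst h1
    simp at nd
  · rw [tri_rotate] at hne
    obtain ⟨rfl, rfl⟩ := tri_inj (by simp at ndt ⊢; tauto) hne
    exact stuDiff_same F h hv hq
  · rw [← tri_rotate] at hne
    obtain ⟨rfl, rfl⟩ := tri_inj (by simp at ndt ⊢; tauto) hne
    exact (stuDiff_same F h hv' hq).symm

/-- STU and invariance under renaming are proved together: independence of the chosen leg for `q +
1` vertices uses both for `q`, and invariance for `q + 1` then follows from STU. -/
theorem isSTU_resolved (n q : ℕ) : IsSTU n q (resolved F n) := by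
  induction q with
  | zero =>
    refine ⟨?_, fun _ hI => absurd hI (Nat.not_lt_zero _)⟩
    rintro K K' σ σ' f ⟨c, I⟩ hv hI
    obtain rfl : I = 0 := by simpa using hI
    induction c using Quotient.inductionOn' with
    | h L => exact Diag.Valid.roundClass_map F (L := L) hv f
  | succ q ih =>
    have stu : ∀ {K : Type} {σ : Pairing K} {x : K} {L : List K} {a b : K}
        {I : Multiset (Cycle K)}, (dg (x :: L) (tri (σ.mate x) a b ::ₘ I)).Valid σ n →
        Multiset.card I < q + 1 →
        resolved F n K σ (dg (x :: L) (tri (σ.mate x) a b ::ₘ I)) =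
          stuDiff (resolved F n) σ L a b I := by
      intro K σ x L a b I hv hI
      rw [resolved, dg_ints, Multiset.card_cons, resolveAux]
      have hex : ∃ p : K × List K × K × K × Multiset (Cycle K),
          dg (x :: L) (tri (σ.mate x) a b ::ₘ I) =
            dg (p.1 :: p.2.1) (tri (σ.mate p.1) p.2.2.1 p.2.2.2.1 ::ₘ p.2.2.2.2) :=
        ⟨(x, L, a, b, I), rfl⟩
      rw [dif_pos hex]
      have hs := hex.choose_spec
      have hc : Multiset.card I = Multiset.card hex.choose.2.2.2.2 := by
        have := congrArg (fun D => Multiset.card D.ints) hs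
        simpa using this
      -- The given leg and the one picked by choice present the same diagram, so `stuDiff_eq`
      -- applies.
      rw [stuDiff_eq F ih hv (by omega) hs, stuDiff, stuDiff, resolved, resolved, dg_ints, dg_ints,
        ← hc]
    refine ⟨?_, stu⟩
    intro K K' σ σ' f D hv hq
    rcases Nat.lt_or_ge (Multiset.card D.ints) (q + 1) with hlt | hge
    · exact ih.map f hv (by omega)
    · have h0 : D.ints ≠ 0 := by
        intro h0
        rw [h0] at hge
        simp at hge
      obtain ⟨x, L, a, b, I, rfl⟩ := hv.exists_leg h0
      have hI : Multiset.card I < q + 1 := by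
        rw [dg_ints, Multiset.card_cons] at hq
        omega
      have hv' := hv.map f
      simp only [dg_map, List.map_cons, Multiset.map_cons, tri_map, f.map_mate] at hv' ⊢
      rw [stu hv hI, stu hv' (by simpa using hI), stuDiff, stuDiff,
        ← ih.map f hv.resolve (by rw [dg_ints]; omega),
        ← ih.map f (hv.resolve.perm (List.Perm.swap _ _ _)) (by rw [dg_ints]; omega)]
      rfl

end

/-! ### Labelled Jacobi diagrams as abstract diagrams -/

/-- The pairing of the half-edges of a labelled Jacobi diagram. -/
def LabelledJacobi.pairing {m q : ℕ} (E : LabelledJacobi m q) : Pairing (HalfEdge m q) :=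
  ⟨E.mate, E.mate_mate, E.mate_ne⟩

/-- The diagram of all half-edges of a labelled Jacobi diagram. -/
def canonicalDiag (m q : ℕ) : Diag (HalfEdge m q) :=
  dg (List.ofFn Sum.inl) (List.ofFn fun v : Fin q =>
    tri (Sum.inr (v, 0) : HalfEdge m q) (Sum.inr (v, 1)) (Sum.inr (v, 2)) : List _)

section

variable {K K' : Type} {σ : Pairing K} {σ' : Pairing K'} {n m q : ℕ}

theorem canonicalDiag_map (g : HalfEdge m q → K) : (canonicalDiag m q).map g =
    dg (List.ofFn fun i => g (Sum.inl i)) (List.ofFn fun v : Fin q =>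
      tri (g (Sum.inr (v, 0))) (g (Sum.inr (v, 1))) (g (Sum.inr (v, 2))) : List _) := by
  simp [canonicalDiag, List.map_ofFn, Function.comp_def]

theorem Diag.map_map {K'' : Type} (f : K → K') (g : K' → K'') (D : Diag K) :
    (D.map f).map g = D.map (g ∘ f) := by
  have : ∀ c : Cycle K, (c.map f).map g = c.map (g ∘ f) := by
    intro c
    induction c using Quotient.inductionOn' with
    | h l => exact congrArg Cycle.ofList (List.map_map ..)
  simp only [Diag.map, Multiset.map_map, this, Function.comp_def]

theorem mem_supp_canonicalDiag (h : HalfEdge m q) : h ∈ (canonicalDiag m q).supp := by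
  rw [canonicalDiag, mem_supp_dg]
  rcases h with i | ⟨v, s⟩
  · exact Or.inl (List.mem_ofFn.2 ⟨i, rfl⟩)
  · refine Or.inr ⟨_, Multiset.mem_coe.2 (List.mem_ofFn.2 ⟨v, rfl⟩), ?_⟩
    fin_cases s <;> simp

theorem card_supp_canonicalDiag :
    Multiset.card (canonicalDiag m q).supp = Fintype.card (HalfEdge m q) := by
  have : ∀ l : List (Cycle (HalfEdge m q)), (∀ t ∈ l, ∃ a b c, t = tri a b c) →
      Multiset.card ((l : Multiset (Cycle (HalfEdge m q))).bind Cycle.toMultiset) = 3 * l.length := by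
    intro l
    induction l with
    | nil => simp
    | cons t l ih =>
      intro h
      obtain ⟨a, b, c, rfl⟩ := h t (by simp)
      rw [← Multiset.cons_coe, Multiset.cons_bind, Multiset.card_add,
        ih fun t ht => h t (by simp [ht])]
      simp [toMultiset_tri]
      ring
  rw [canonicalDiag, supp_dg, Multiset.card_add, this]
  · simp
    ring
  · intro t ht
    obtain ⟨v, rfl⟩ := List.mem_ofFn.1 ht
    exact ⟨_, _, _, rfl⟩

/-- By counting: every half-edge occurs, and there are no more entries than half-edges. -/
theorem nodup_supp_canonicalDiag : (canonicalDiag m q).supp.Nodup := by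
  have h : (Finset.univ : Finset (HalfEdge m q)).val ≤ (canonicalDiag m q).supp :=
    (Multiset.le_iff_subset Finset.univ.nodup).2 fun h _ => mem_supp_canonicalDiag h
  have := Multiset.eq_of_le_of_card_le h (by rw [card_supp_canonicalDiag]; rfl)
  rw [← this]
  exact Finset.univ.nodup

theorem mem_ints_canonicalDiag {t : Cycle (HalfEdge m q)} (ht : t ∈ (canonicalDiag m q).ints) :
    ∃ v, t = tri (Sum.inr (v, 0)) (Sum.inr (v, 1)) (Sum.inr (v, 2)) := by
  obtain ⟨v, rfl⟩ := List.mem_ofFn.1 (Multiset.mem_coe.1 ht)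
  exact ⟨v, rfl⟩

theorem canonicalDiag_valid (E : LabelledJacobi m q) (h : m + q = 2 * n) :
    (canonicalDiag m q).Valid E.pairing n where
  nodup := nodup_supp_canonicalDiag
  closed _ _ := mem_supp_canonicalDiag _
  three t ht := by
    obtain ⟨v, rfl⟩ := mem_ints_canonicalDiag ht
    exact ⟨_, _, _, rfl⟩
  conn P h1 h2 h3 t ht a ha hPa := by
    obtain ⟨v, rfl⟩ := mem_ints_canonicalDiag ht
    have sat : ∀ (a b : HalfEdge m q), a.vertex = b.vertex → P a → P b := by
      rintro (i | ⟨v, s⟩) (j | ⟨w, u⟩) hab hP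
      · obtain rfl : i = j := by simpa [HalfEdge.vertex] using hab
        exact hP
      · simp [HalfEdge.vertex] at hab
      · simp [HalfEdge.vertex] at hab
      · obtain rfl : v = w := by simpa [HalfEdge.vertex] using hab
        refine h2 (tri (Sum.inr (v, 0)) (Sum.inr (v, 1)) (Sum.inr (v, 2))) ?_ _ ?_ _ ?_ hP
        · exact Multiset.mem_coe.2 (List.mem_ofFn.2 ⟨v, rfl⟩)
        · fin_cases s <;> simp
        · fin_cases u <;> simp
    obtain ⟨p, hp⟩ := E.connected v
    have key : ∀ w : Fin m ⊕ Fin q, Relation.ReflTransGen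
        (fun a b => ∃ h : HalfEdge m q, h.vertex = a ∧ (E.mate h).vertex = b) (Sum.inr v) w →
        ∀ b : HalfEdge m q, b.vertex = w → P b := by
      intro w hw
      induction hw with
      | refl =>
        intro b hb
        refine sat a b ?_ hPa
        rw [hb]
        simp only [mem_tri] at ha
        rcases ha with rfl | rfl | rfl <;> rfl
      | tail _ hst ih =>
        obtain ⟨h, hh, hh'⟩ := hst
        intro b hb
        exact sat (E.mate h) b (hh'.trans hb.symm) (h1 h (ih h hh))
    refine h3 (Sum.inl p) ?_ (key _ hp (Sum.inl p) rfl)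
    rw [canonicalDiag, dg_circ, Cycle.mem_coe_iff]
    exact List.mem_ofFn.2 ⟨p, rfl⟩
  card := by simpa [canonicalDiag] using h

/-- Validity forces `g` to be injective with image closed under `σ`, so the pairing can be pulled
back; connectedness comes from `conn` applied to the half-edges whose vertex is reachable from `v`.
-/
theorem exists_labelledJacobi {g : HalfEdge m q → K}
    (hv : ((canonicalDiag m q).map g).Valid σ n) :
    ∃ (E : LabelledJacobi m q) (f : PairingEmb E.pairing σ), f.toFun = g := by
  have nd := hv.nodup
  have hcl := hv.closed
  rw [Diag.supp_map] at nd hcl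
  have hg : Function.Injective g := fun a b hab =>
    Multiset.inj_on_of_nodup_map nd a (mem_supp_canonicalDiag a) b (mem_supp_canonicalDiag b) hab
  obtain ⟨μ, h1, h2, h3⟩ := exists_mate (σ := σ) hg fun x => by
    obtain ⟨y, -, hy⟩ := Multiset.mem_map.1
      (hcl (g x) (Multiset.mem_map_of_mem _ (mem_supp_canonicalDiag x)))
    exact ⟨y, hy⟩
  refine ⟨⟨μ, h1, h2, fun v => ?_⟩, ⟨g, hg, h3⟩, rfl⟩
  by_contra! hno
  have hmem : ∀ v : Fin q, tri (g (Sum.inr (v, 0))) (g (Sum.inr (v, 1))) (g (Sum.inr (v, 2))) ∈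
      ((canonicalDiag m q).map g).ints := by
    intro v
    rw [canonicalDiag_map]
    exact Multiset.mem_coe.2 (List.mem_ofFn.2 ⟨v, rfl⟩)
  refine hv.conn (fun k => ∃ h, g h = k ∧ Relation.ReflTransGen
      (fun a b => ∃ h : HalfEdge m q, h.vertex = a ∧ (μ h).vertex = b) (Sum.inr v) h.vertex)
    ?_ ?_ ?_ _ (hmem v) (g (Sum.inr (v, 0))) (by simp) ⟨_, rfl, Relation.ReflTransGen.refl⟩
  · rintro _ ⟨h, rfl, hr⟩
    exact ⟨μ h, h3 h, hr.tail ⟨h, rfl, rfl⟩⟩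
  · intro t ht a ha b hb
    rw [canonicalDiag_map] at ht
    obtain ⟨w, rfl⟩ := List.mem_ofFn.1 (Multiset.mem_coe.1 ht)
    have hw : ∀ a ∈ tri (g (Sum.inr (w, 0))) (g (Sum.inr (w, 1))) (g (Sum.inr (w, 2))),
        ∃ s, a = g (Sum.inr (w, s)) := by
      intro a ha
      rcases mem_tri.1 ha with rfl | rfl | rfl
      exacts [⟨_, rfl⟩, ⟨_, rfl⟩, ⟨_, rfl⟩]
    obtain ⟨s, rfl⟩ := hw a ha
    obtain ⟨u, rfl⟩ := hw b hb
    rintro ⟨h, hh, hr⟩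
    rw [hg hh] at hr
    exact ⟨_, rfl, hr⟩
  · intro k hk
    rw [canonicalDiag_map, dg_circ, Cycle.mem_coe_iff] at hk
    obtain ⟨i, rfl⟩ := List.mem_ofFn.1 hk
    rintro ⟨h, hh, hr⟩
    rw [hg hh] at hr
    exact hno i hr

theorem exists_ofFn_tri {I : Multiset (Cycle K)} (h : ∀ t ∈ I, ∃ a b c, t = tri a b c) :
    ∃ (q : ℕ) (T : Fin q → Fin 3 → K),
      I = (List.ofFn fun v => tri (T v 0) (T v 1) (T v 2) : List (Cycle K)) := by
  induction I using Quotient.inductionOn with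
  | h l =>
  have h3 : ∀ v : Fin l.length, ∃ t : Fin 3 → K, l.get v = tri (t 0) (t 1) (t 2) := by
    intro v
    obtain ⟨a, b, c, h⟩ := h (l.get v) (Multiset.mem_coe.2 (List.get_mem l v))
    exact ⟨![a, b, c], h⟩
  choose T hT using h3
  refine ⟨l.length, T, ?_⟩
  simp only [← hT]
  rw [show (List.ofFn fun v => l.get v) = l from List.ofFn_get l]
  rfl

theorem exists_eq_canonicalDiag_map {D : Diag K} (hv : D.Valid σ n) :
    ∃ (m q : ℕ) (g : HalfEdge m q → K), m + q = 2 * n ∧ D = (canonicalDiag m q).map g := by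
  obtain ⟨c, I⟩ := D
  induction c using Quotient.inductionOn' with
  | h L =>
  obtain ⟨q, T, rfl⟩ := exists_ofFn_tri hv.three
  refine ⟨L.length, q, Sum.elim L.get fun p => T p.1 p.2, by simpa using hv.card, ?_⟩
  rw [canonicalDiag_map]
  simp only [Sum.elim_inl, Sum.elim_inr, List.ofFn_get]
  rfl

/-- Equal circles differ in numbering by a rotation and equal multisets of triples by a permutation
with a rotation at each vertex. These are the data of a relabelling, and injectivity of `f` turns
them into an isomorphism. -/
theorem toJacobi_eq {m' q' : ℕ} {E : LabelledJacobi m q} {E' : LabelledJacobi m' q'}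
    (h : m + q = 2 * n) (h' : m' + q' = 2 * n) (f : PairingEmb E.pairing σ)
    (f' : PairingEmb E'.pairing σ)
    (e : (canonicalDiag m q).map f.toFun = (canonicalDiag m' q').map f'.toFun) :
    E.toJacobi h = E'.toJacobi h' := by
  rw [canonicalDiag_map, canonicalDiag_map] at e
  have ec := congrArg Diag.circ e
  have ei := congrArg Diag.ints e
  simp only [dg_circ, dg_ints] at ec ei
  obtain rfl : m = m' := by simpa using congrArg Cycle.length ec
  obtain rfl : q = q' := by simpa using congrArg Multiset.card ei
  obtain ⟨c, hc⟩ := exists_finRotate ec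
  have hgr : ∀ v : Fin q, ∃ (w : Fin q) (r : Fin 3), ∀ s,
      f'.toFun (Sum.inr (v, s)) = f.toFun (Sum.inr (w, s + r)) := by
    intro v
    have hm : tri (f'.toFun (Sum.inr (v, 0))) (f'.toFun (Sum.inr (v, 1)))
        (f'.toFun (Sum.inr (v, 2))) ∈ (List.ofFn fun v : Fin q => tri (f.toFun (Sum.inr (v, 0)))
          (f.toFun (Sum.inr (v, 1))) (f.toFun (Sum.inr (v, 2))) : Multiset (Cycle K)) := by
      rw [ei]
      exact Multiset.mem_coe.2 (List.mem_ofFn.2 ⟨v, rfl⟩)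
    obtain ⟨w, hw⟩ := List.mem_ofFn.1 (Multiset.mem_coe.1 hm)
    refine ⟨w, ?_⟩
    have hmem : f'.toFun (Sum.inr (v, 0)) ∈ tri (f.toFun (Sum.inr (w, 0)))
        (f.toFun (Sum.inr (w, 1))) (f.toFun (Sum.inr (w, 2))) := by
      rw [hw]
      simp
    have nd : ∀ a b c : Fin 3, a ≠ b → a ≠ c → b ≠ c →
        [f.toFun (Sum.inr (w, a)), f.toFun (Sum.inr (w, b)), f.toFun (Sum.inr (w, c))].Nodup := by
      intro a b c hab hac hbc
      simp [f.inj.eq_iff, hab, hac, hbc]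
    rcases mem_tri.1 hmem with h0 | h0 | h0
    · rw [h0] at hw
      obtain ⟨h1, h2⟩ := tri_inj (nd 0 1 2 (by decide) (by decide) (by decide)) hw
      refine ⟨0, fun s => ?_⟩
      fin_cases s
      exacts [h0, h1.symm, h2.symm]
    · rw [h0, tri_rotate] at hw
      obtain ⟨h1, h2⟩ := tri_inj (nd 1 2 0 (by decide) (by decide) (by decide)) hw
      refine ⟨1, fun s => ?_⟩
      fin_cases s
      exacts [h0, h1.symm, h2.symm]
    · rw [h0, ← tri_rotate] at hw
      obtain ⟨h1, h2⟩ := tri_inj (nd 2 0 1 (by decide) (by decide) (by decide)) hw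
      refine ⟨2, fun s => ?_⟩
      fin_cases s
      exacts [h0, h1.symm, h2.symm]
  choose w r hwr using hgr
  -- If two vertices had the same image under `w`, suitable half-edges at them would have the same
  -- image under `f'`.
  have hw : Function.Injective w := by
    intro v v' hvv
    have h1 := hwr v 0
    have h2 := hwr v' (r v - r v')
    rw [← hvv, sub_add_cancel] at h2
    rw [zero_add, ← h2] at h1
    have h3 := f'.inj h1
    simp only [Sum.inr.injEq, Prod.mk.injEq] at h3
    exact h3.1
  have key : ∀ h, f'.toFun h =
      f.toFun (relabel c (Equiv.ofBijective w (Finite.injective_iff_bijective.1 hw)) r h) := by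
    rintro (i | ⟨v, s⟩)
    · exact hc i
    · exact hwr v s
  have rel : (LabelledJacobi.setoid m q).r E' E := by
    refine ⟨c, Equiv.ofBijective w (Finite.injective_iff_bijective.1 hw), r, fun h => f.inj ?_⟩
    have e1 := f'.map_mate h
    have e2 := f.map_mate (relabel c (Equiv.ofBijective w (Finite.injective_iff_bijective.1 hw)) r h)
    rw [key, key] at e1
    exact e1.trans e2.symm
  have := Quotient.sound (s := LabelledJacobi.setoid m q) rel
  simp only [LabelledJacobi.toJacobi]
  rw [this]

variable (F : Type*) [Field F]

open Classical in
/-- The class of the Jacobi diagram presented by an abstract diagram. -/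
noncomputable def jacobiClass (n : ℕ) (K : Type) (σ : Pairing K) (D : Diag K) : JacobiSpace F n :=
  if h : ∃ (J : JacobiDiagram n) (m q : ℕ) (h : m + q = 2 * n) (E : LabelledJacobi m q)
      (f : PairingEmb E.pairing σ), D = (canonicalDiag m q).map f.toFun ∧ J = E.toJacobi h then
    h.choose.toSpace F else 0

theorem jacobiClass_eq {E : LabelledJacobi m q} (h : m + q = 2 * n) (f : PairingEmb E.pairing σ) :
    jacobiClass F n K σ ((canonicalDiag m q).map f.toFun) = (E.toJacobi h).toSpace F := by
  have hex : ∃ (J : JacobiDiagram n) (m' q' : ℕ) (h : m' + q' = 2 * n) (E : LabelledJacobi m' q')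
      (f' : PairingEmb E.pairing σ), (canonicalDiag m q).map f.toFun =
        (canonicalDiag m' q').map f'.toFun ∧ J = E.toJacobi h := ⟨_, _, _, h, E, f, rfl, rfl⟩
  rw [jacobiClass, dif_pos hex]
  obtain ⟨m', q', h', E', f', e, hJ⟩ := hex.choose_spec
  rw [hJ, toJacobi_eq h h' f f' e]

theorem canonicalDiag_succ (m q : ℕ) : canonicalDiag (m + 1) (q + 1) =
    dg (Sum.inl (Fin.last m) :: List.ofFn fun i : Fin m => Sum.inl i.castSucc)
      (tri (Sum.inr (Fin.last q, 0)) (Sum.inr (Fin.last q, 1)) (Sum.inr (Fin.last q, 2)) ::ₘ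
        (List.ofFn fun v : Fin q => tri (Sum.inr (v.castSucc, (0 : Fin 3)))
          (Sum.inr (v.castSucc, (1 : Fin 3))) (Sum.inr (v.castSucc, (2 : Fin 3))) :
          List (Cycle (HalfEdge (m + 1) (q + 1))))) := by
  rw [canonicalDiag, List.ofFn_succ', List.ofFn_succ' (n := q), List.concat_eq_append,
    List.concat_eq_append, dg_append_comm]
  congr 1
  rw [Multiset.cons_coe, Multiset.coe_eq_coe]
  exact List.perm_append_singleton _ _

theorem canonicalDiag_resolve (m q : ℕ) (s t : Fin 3) :
    (canonicalDiag (m + 2) q).map (resolveHalfEdge s t) =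
      dg (Sum.inr (Fin.last q, s) :: Sum.inr (Fin.last q, t) ::
          List.ofFn fun i : Fin m => Sum.inl i.castSucc)
        (List.ofFn fun v : Fin q => tri (Sum.inr (v.castSucc, (0 : Fin 3)))
          (Sum.inr (v.castSucc, (1 : Fin 3))) (Sum.inr (v.castSucc, (2 : Fin 3))) :
          List (Cycle (HalfEdge (m + 1) (q + 1)))) := by
  rw [canonicalDiag_map, List.ofFn_succ', List.ofFn_succ', List.concat_eq_append,
    List.concat_eq_append, List.append_assoc, dg_append_comm]
  simp [resolveHalfEdge]

theorem resolveHalfEdge_injective {s t : Fin 3} (hst : s ≠ t) :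
    Function.Injective (resolveHalfEdge s t : HalfEdge (m + 2) q → HalfEdge (m + 1) (q + 1)) := by
  rintro (i | ⟨v, k⟩) (j | ⟨w, l⟩) h
  · induction i using Fin.lastCases with
    | last =>
      induction j using Fin.lastCases with
      | last => rfl
      | cast j =>
        induction j using Fin.lastCases with
        | last => simp [resolveHalfEdge, hst.symm] at h
        | cast j => simp [resolveHalfEdge] at h
    | cast i =>
      induction i using Fin.lastCases with
      | last =>
        induction j using Fin.lastCases with
        | last => simp [resolveHalfEdge, hst] at h
        | cast j =>
          induction j using Fin.lastCases with
          | last => rfl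
          | cast j => simp [resolveHalfEdge] at h
      | cast i =>
        induction j using Fin.lastCases with
        | last => simp [resolveHalfEdge] at h
        | cast j =>
          induction j using Fin.lastCases with
          | last => simp [resolveHalfEdge] at h
          | cast j => simpa [resolveHalfEdge] using h
  · induction i using Fin.lastCases with
    | last => simp [resolveHalfEdge, (Fin.castSucc_lt_last w).ne'] at h
    | cast i =>
      induction i using Fin.lastCases with
      | last => simp [resolveHalfEdge, (Fin.castSucc_lt_last w).ne'] at h
      | cast i => simp [resolveHalfEdge] at h
  · induction j using Fin.lastCases with
    | last => simp [resolveHalfEdge, (Fin.castSucc_lt_last v).ne] at h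
    | cast j =>
      induction j using Fin.lastCases with
      | last => simp [resolveHalfEdge, (Fin.castSucc_lt_last v).ne] at h
      | cast j => simp [resolveHalfEdge] at h
  · simpa [resolveHalfEdge] using h

/-- Any leg can be numbered so that it joins the last external vertex to the half-edge `0` of the
last internal one, the position in which the STU relators are stated. -/
theorem isSTU_jacobiClass (n q : ℕ) : IsSTU n q (jacobiClass F n) := by
  refine ⟨?_, ?_⟩
  · intro K K' σ σ' f D hv _
    obtain ⟨m, q, g, hmq, rfl⟩ := exists_eq_canonicalDiag_map hv
    obtain ⟨E, e, rfl⟩ := exists_labelledJacobi hv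
    rw [jacobiClass_eq F hmq e, Diag.map_map]
    exact jacobiClass_eq F hmq (σ := σ') ⟨f.toFun ∘ e.toFun, f.inj.comp e.inj, fun k => by
      simp [e.map_mate, f.map_mate]⟩
  · intro K σ x L a b I hv _
    obtain ⟨m, hm⟩ : ∃ m, L.length = m := ⟨_, rfl⟩
    obtain ⟨w, rfl⟩ := exists_ofFn_eq hm
    obtain ⟨q, T, rfl⟩ := exists_ofFn_tri fun t ht => hv.three t (Multiset.mem_cons_of_mem ht)
    -- The half-edges `1` and `2` of the last vertex are `a` and `b`, so the order `b, a` of `T` is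
    -- the resolution `2 1`.
    let g : HalfEdge (m + 1) (q + 1) → K := Sum.elim (Fin.snoc w x) fun p =>
      (Fin.snoc T ![σ.mate x, a, b] : Fin (q + 1) → Fin 3 → K) p.1 p.2
    have eS : dg (x :: List.ofFn w) (tri (σ.mate x) a b ::ₘ (List.ofFn fun v =>
        tri (T v 0) (T v 1) (T v 2) : List (Cycle K))) =
        (canonicalDiag (m + 1) (q + 1)).map g := by
      rw [canonicalDiag_succ]
      simp [g, List.map_ofFn, Function.comp_def]
    have eT : dg (b :: a :: List.ofFn w) (List.ofFn fun v =>
        tri (T v 0) (T v 1) (T v 2) : List (Cycle K)) =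
        (canonicalDiag (m + 2) q).map (g ∘ resolveHalfEdge 2 1) := by
      rw [← Diag.map_map, canonicalDiag_resolve]
      simp [g, List.map_ofFn, Function.comp_def]
    have eU : dg (a :: b :: List.ofFn w) (List.ofFn fun v =>
        tri (T v 0) (T v 1) (T v 2) : List (Cycle K)) =
        (canonicalDiag (m + 2) q).map (g ∘ resolveHalfEdge 1 2) := by
      rw [← Diag.map_map, canonicalDiag_resolve]
      simp [g, List.map_ofFn, Function.comp_def]
    have hc := hv.card
    simp only [dg_circ, dg_ints, Cycle.length_coe, List.length_cons, List.length_ofFn,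
      Multiset.card_cons, Multiset.coe_card] at hc
    have hT := hv.resolve
    have hU := hT.perm (List.Perm.swap _ _ _)
    rw [eT] at hT
    rw [eU] at hU
    rw [eS] at hv
    obtain ⟨S, fS, hS⟩ := exists_labelledJacobi hv
    obtain ⟨T', fT, hT⟩ := exists_labelledJacobi hT
    obtain ⟨U, fU, hU⟩ := exists_labelledJacobi hU
    rw [eS, eT, eU, ← hT, ← hU, ← hS, jacobiClass_eq F hc fS,
      jacobiClass_eq F (by omega) fT, jacobiClass_eq F (by omega) fU]
    have key : (Finsupp.single (S.toJacobi hc) 1 - (Finsupp.single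
        (T'.toJacobi (n := n) (by omega)) 1 - Finsupp.single (U.toJacobi (n := n) (by omega))
        (1 : F))) ∈ Submodule.span F (stuRelators F n) := by
      refine Submodule.subset_span ⟨m, q, hc, by omega, S, T', U, ?_, ?_, ?_, rfl⟩
      · refine fS.inj ((fS.map_mate (Sum.inl (Fin.last m))).trans ?_)
        rw [hS]
        simp [g]
      · intro h
        have e1 := fT.map_mate h
        rw [hT, ← hS] at e1
        exact fS.inj (e1.trans (fS.map_mate (resolveHalfEdge 2 1 h)).symm)
      · intro h
        have e1 := fU.map_mate h
        rw [hU, ← hS] at e1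
        exact fS.inj (e1.trans (fS.map_mate (resolveHalfEdge 1 2 h)).symm)
    have key' := (Submodule.Quotient.mk_eq_zero _).2 key
    simp only [Submodule.Quotient.mk_sub] at key'
    exact sub_eq_zero.1 key'

end

/-! ### The isomorphism between round chord diagrams and Jacobi diagrams -/

section

variable {K : Type} {σ : Pairing K} {n : ℕ} (F : Type*) [Field F]

/-- The linear map on a space of diagrams modulo relators given by its values on diagrams. -/
noncomputable def relatorLift {X M : Type*} [AddCommGroup M] [Module F M] (R : Set (X →₀ F))
    (φ : X → M) (h : ∀ r ∈ R, Finsupp.linearCombination F φ r = 0) :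
    ((X →₀ F) ⧸ Submodule.span F R) →ₗ[F] M :=
  (Submodule.span F R).liftQ (Finsupp.linearCombination F φ) (Submodule.span_le.2 h)

theorem relatorLift_single {X M : Type*} [AddCommGroup M] [Module F M] {R : Set (X →₀ F)}
    {φ : X → M} (h : ∀ r ∈ R, Finsupp.linearCombination F φ r = 0) (x : X) :
    relatorLift F R φ h (Submodule.Quotient.mk (Finsupp.single x 1)) = φ x := by
  simp [relatorLift]

theorem relatorSpace_induction {X : Type*} {R : Set (X →₀ F)}
    {S : Submodule F ((X →₀ F) ⧸ Submodule.span F R)}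
    (h : ∀ x, Submodule.Quotient.mk (Finsupp.single x 1) ∈ S) : S = ⊤ := by
  rw [eq_top_iff]
  rintro v -
  obtain ⟨v, rfl⟩ := Submodule.Quotient.mk_surjective _ v
  induction v using Finsupp.induction_linear with
  | zero => exact S.zero_mem
  | add f g hf hg => exact S.add_mem hf hg
  | single x c =>
    have := S.smul_mem c (h x)
    rwa [← Submodule.Quotient.mk_smul, Finsupp.smul_single, smul_eq_mul, mul_one] at this

theorem IsRound.jacobiClass_eq {c : Cycle K} {D : BasedRound n} {g : Fin (2 * n) → K}
    (h : IsRound σ c D g) :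
    jacobiClass F n K σ ⟨c, 0⟩ = D.toRound.toJacobi.toSpace F := by
  let f : PairingEmb D.toLabelledJacobi.pairing σ :=
    { toFun := Sum.elim g fun p => p.1.elim0
      inj := by
        rintro (i | ⟨v, -⟩) (j | ⟨w, -⟩) hij
        · exact congrArg _ (h.inj hij)
        · exact w.elim0
        · exact v.elim0
        · exact v.elim0
      map_mate := by
        rintro (i | ⟨v, -⟩)
        · exact h.map_mate i
        · exact v.elim0 }
  have e : (⟨c, 0⟩ : Diag K) = (canonicalDiag (2 * n) 0).map f.toFun := by
    rw [canonicalDiag_map, h.eq]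
    rfl
  rw [e, ChordDiagrams.jacobiClass_eq F (n := n) rfl f]
  rfl

open Classical in
/-- The pairing in which a new element is paired with the only fixed point of an involution. -/
noncomputable def optionPairing {X : Type} (τ : Equiv.Perm X) (z : X) (h : ∀ y, τ (τ y) = y)
    (hz : ∀ y, τ y = y ↔ y = z) : Pairing (Option X) where
  mate k := k.elim (some z) fun y => if y = z then none else some (τ y)
  mate_mate := by
    have h0 : τ z = z := (hz z).2 rfl
    rintro (_ | y)
    · simp
    · by_cases hy : y = z
      · simp [hy]
      · have : τ y ≠ z := fun e => hy (by rw [← h y, e, h0])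
        simp [hy, this, h]
  mate_ne := by
    rintro (_ | y)
    · simp
    · by_cases hy : y = z
      · simp [hy]
      · simp [hy, hz]

theorem isRound_of_isInsertion {k : ℕ} {τ : Equiv.Perm (Fin (2 * k + 1))} {z : Fin (2 * k + 1)}
    {p : Fin (2 * k + 1 + 1)} {D : BasedRound (k + 1)} (hD : IsInsertion τ z p D)
    (h : ∀ y, τ (τ y) = y) (hz : ∀ y, τ y = y ↔ y = z) :
    IsRound (optionPairing τ z h hz) (((List.ofFn some).insertIdx p none :
      List (Option (Fin (2 * k + 1)))) : Cycle (Option (Fin (2 * k + 1))))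
      D (p.insertNth none some : Fin (2 * (k + 1)) → Option _) where
  inj := by
    have : Function.Injective
        (p.insertNth none some : Fin (2 * k + 1 + 1) → Option (Fin (2 * k + 1))) := by
      intro a b hab
      rcases Fin.eq_self_or_eq_succAbove p a with ha | ⟨a, rfl⟩ <;>
        rcases Fin.eq_self_or_eq_succAbove p b with hb | ⟨b, rfl⟩ <;> simp_all
    exact this
  map_mate a := by
    rcases Fin.eq_self_or_eq_succAbove p a with rfl | ⟨a, rfl⟩
    · rw [hD.1]
      simp [optionPairing]
    · by_cases ha : a = z
      · subst ha
        have e : D.mate (p.succAbove a) = p := by rw [← hD.1, D.mate_mate]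
        rw [e]
        simp [optionPairing]
      · rw [hD.2 a ha]
        simp [optionPairing, ha]
  eq := by rw [← ofFn_insertNth]

theorem valid_optionPairing {k : ℕ} {τ : Equiv.Perm (Fin (2 * k + 1))} {z : Fin (2 * k + 1)}
    (h : ∀ y, τ (τ y) = y) (hz : ∀ y, τ y = y ↔ y = z) :
    (dg (none :: List.ofFn some) 0).Valid (optionPairing τ z h hz) (k + 1) where
  nodup := by
    rw [supp_dg, Multiset.zero_bind, add_zero, Multiset.coe_nodup, List.nodup_cons,
      List.nodup_ofFn, List.mem_ofFn]
    exact ⟨by simp, Option.some_injective _⟩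
  closed := by
    have : ∀ o : Option (Fin (2 * k + 1)), o ∈ (dg (none :: List.ofFn some) 0).supp := by
      rintro (_ | y) <;> rw [mem_supp_dg]
      · simp
      · exact Or.inl (List.mem_cons_of_mem _ (List.mem_ofFn.2 ⟨y, rfl⟩))
    exact fun k _ => this _
  three := by simp
  conn := by simp
  card := by
    simp
    ring

/-- This is `IsSTU.fourT_insertIdx` for `jacobiClass`. The auxiliary diagram has a single internal
vertex, whence the bound `1`; the inserted end is named `none`. -/
theorem roundFourTerm_toJacobi (n : ℕ) (r : RoundDiagram n →₀ F)
    (hr : r ∈ roundFourTermRelators F n) :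
    Finsupp.linearCombination F (fun D : RoundDiagram n => D.toJacobi.toSpace F) r = 0 := by
  cases n with
  | zero => exact absurd hr (Set.notMem_empty _)
  | succ k =>
    obtain ⟨τ, z, x, A, B, C, D, h, hz, hx, hA, hB, hC, hD, rfl⟩ := hr
    have key := (isSTU_jacobiClass F (k + 1) 1).fourT_insertIdx (valid_optionPairing h hz)
      (by simp) (i := x) (j := τ x) (by rw [List.length_ofFn]; exact x.2)
      (by rw [List.length_ofFn]; exact (τ x).2)
      (by rw [List.getElem_ofFn, List.getElem_ofFn]; simp [optionPairing, hx])
    have hA' := (isRound_of_isInsertion hA h hz).jacobiClass_eq F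
    have hB' := (isRound_of_isInsertion hB h hz).jacobiClass_eq F
    have hC' := (isRound_of_isInsertion hC h hz).jacobiClass_eq F
    have hD' := (isRound_of_isInsertion hD h hz).jacobiClass_eq F
    simp only [Fin.val_castSucc, Fin.val_succ] at hA' hB' hC' hD'
    simp only [dg, hA', hB', hC', hD'] at key
    simp only [map_sub, map_add, Finsupp.linearCombination_single, one_smul]
    rw [← key]
    abel

/-- The map from round chord diagrams to Jacobi diagrams. -/
noncomputable def roundToJacobi (n : ℕ) : RoundSpace F n →ₗ[F] JacobiSpace F n :=
  relatorLift F _ (fun D : RoundDiagram n => D.toJacobi.toSpace F) (roundFourTerm_toJacobi F n)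

theorem roundToJacobi_toSpace (D : RoundDiagram n) :
    roundToJacobi F n (D.toSpace F) = D.toJacobi.toSpace F :=
  relatorLift_single F _ D

/-- Induction on the number of internal vertices: STU at a leg leaves two diagrams with one vertex
fewer. -/
theorem jacobiClass_mem_range {D : Diag K} (hv : D.Valid σ n) :
    jacobiClass F n K σ D ∈ LinearMap.range (roundToJacobi F n) := by
  obtain ⟨q, hq⟩ : ∃ q, Multiset.card D.ints = q := ⟨_, rfl⟩
  induction q generalizing D with
  | zero =>
    obtain ⟨c, I⟩ := D
    obtain rfl : I = 0 := by simpa using hq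
    induction c using Quotient.inductionOn' with
    | h L =>
      obtain ⟨g, hg⟩ := hv.exists_ofFn
      obtain ⟨D, hD⟩ := hv.exists_isRound hg
      exact ⟨D.toRound.toSpace F, (roundToJacobi_toSpace F _).trans (hD.jacobiClass_eq F).symm⟩
  | succ q ih =>
    obtain ⟨x, L, a, b, I, rfl⟩ := hv.exists_leg (fun h0 => by simp [h0] at hq)
    rw [dg_ints, Multiset.card_cons, add_left_inj] at hq
    rw [(isSTU_jacobiClass F n (q + 1)).stu hv (by omega)]
    exact Submodule.sub_mem _ (ih hv.resolve hq)
      (ih (hv.resolve.perm (List.Perm.swap _ _ _)) hq)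

theorem roundToJacobi_surjective (n : ℕ) : Function.Surjective (roundToJacobi F n) := by
  rw [← LinearMap.range_eq_top]
  refine relatorSpace_induction F ?_
  rintro ⟨⟨⟨m, q⟩, h⟩, E⟩
  induction E using Quotient.inductionOn with
  | h E =>
    have e := jacobiClass_eq F h (E := E) (σ := E.pairing) ⟨id, Function.injective_id, fun _ => rfl⟩
    have e2 : (E.toJacobi h).toSpace F ∈ LinearMap.range (roundToJacobi F n) := by
      rw [← e]
      exact jacobiClass_mem_range F ((canonicalDiag_valid E h).map _)
    exact e2

/-- A relabelling fixes the canonical diagram, since it only rotates cycles and permutes a multiset;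
what changes is the pairing, and `resolved` is invariant under renaming. -/
theorem resolved_eq_of_rel {m q : ℕ} (h : m + q = 2 * n) {E E' : LabelledJacobi m q}
    (hE : (LabelledJacobi.setoid m q).r E E') :
    resolved F n _ E.pairing (canonicalDiag m q) = resolved F n _ E'.pairing (canonicalDiag m q) := by
  obtain ⟨c, f, r, H⟩ := hE
  let φ : PairingEmb E.pairing E'.pairing := ⟨relabel c f r, fun a b hab => by
    rw [← relabel_symm_relabel c f r a, hab, relabel_symm_relabel], H⟩
  have e : (canonicalDiag m q).map φ.toFun = canonicalDiag m q := by
    rw [canonicalDiag_map, canonicalDiag]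
    refine Diag.ext ?_ ?_
    · exact ofFn_comp_finRotate (fun i : Fin m => (Sum.inl i : HalfEdge m q)) c
    · simp only [dg_ints]
      have hr : ∀ v : Fin q, tri (φ.toFun (Sum.inr (v, 0))) (φ.toFun (Sum.inr (v, 1)))
          (φ.toFun (Sum.inr (v, 2))) = tri (Sum.inr (f v, 0) : HalfEdge m q) (Sum.inr (f v, 1))
          (Sum.inr (f v, 2)) := by
        intro v
        change tri (Sum.inr (f v, 0 + r v) : HalfEdge m q) (Sum.inr (f v, 1 + r v))
          (Sum.inr (f v, 2 + r v)) = _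
        generalize r v = s
        fin_cases s
        · rfl
        · exact (tri_rotate _ _ _).symm
        · exact tri_rotate _ _ _
      simp only [hr]
      exact Multiset.coe_eq_coe.2 (Equiv.Perm.ofFn_comp_perm f fun v : Fin q =>
        tri (Sum.inr (v, 0) : HalfEdge m q) (Sum.inr (v, 1)) (Sum.inr (v, 2)))
  rw [← e, (isSTU_resolved F n q).map φ (canonicalDiag_valid E h) (by simp [canonicalDiag]), e]

/-- The combination of round chord diagrams represented by a Jacobi diagram. -/
noncomputable def JacobiDiagram.resolve (J : JacobiDiagram n) : RoundSpace F n :=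
  Quotient.lift (s := LabelledJacobi.setoid J.1.1.1 J.1.1.2)
    (fun E => resolved F n _ E.pairing (canonicalDiag J.1.1.1 J.1.1.2))
    (fun _ _ hE => resolved_eq_of_rel F J.1.2 hE) J.2

theorem resolve_toJacobi {m q : ℕ} (E : LabelledJacobi m q) (h : m + q = 2 * n) :
    (E.toJacobi h).resolve F = resolved F n _ E.pairing (canonicalDiag m q) := rfl

theorem resolved_eq_of_isResolution {m q : ℕ} {s t : Fin 3} (hst : s ≠ t)
    (h : (m + 2) + q = 2 * n) {S : LabelledJacobi (m + 1) (q + 1)} {T : LabelledJacobi (m + 2) q}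
    (hT : IsResolution s t S T) :
    resolved F n _ T.pairing (canonicalDiag (m + 2) q) =
      resolved F n _ S.pairing ((canonicalDiag (m + 2) q).map (resolveHalfEdge s t)) :=
  ((isSTU_resolved F n q).map (σ := T.pairing) (σ' := S.pairing)
    ⟨resolveHalfEdge s t, resolveHalfEdge_injective hst, hT⟩ (canonicalDiag_valid T h)
    (by simp [canonicalDiag])).symm

theorem stu_resolve (n : ℕ) (r : JacobiDiagram n →₀ F) (hr : r ∈ stuRelators F n) :
    Finsupp.linearCombination F (fun J : JacobiDiagram n => J.resolve F) r = 0 := by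
  obtain ⟨m, q, h₁, h₂, S, T, U, hS, hT, hU, rfl⟩ := hr
  simp only [map_sub, Finsupp.linearCombination_single, one_smul, resolve_toJacobi]
  rw [resolved_eq_of_isResolution F (by decide) h₂ hT,
    resolved_eq_of_isResolution F (by decide) h₂ hU, canonicalDiag_resolve, canonicalDiag_resolve]
  have hv := canonicalDiag_valid S h₁
  have hS' : S.pairing.mate (Sum.inl (Fin.last m)) = Sum.inr (Fin.last q, 0) := hS
  rw [canonicalDiag_succ, ← hS'] at hv ⊢
  rw [(isSTU_resolved F n (q + 1)).stu hv (by simp), sub_self]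

/-- The inverse of the map from round chord diagrams to Jacobi diagrams. -/
noncomputable def jacobiToRound (n : ℕ) : JacobiSpace F n →ₗ[F] RoundSpace F n :=
  relatorLift F _ (fun J : JacobiDiagram n => J.resolve F) (stu_resolve F n)

theorem jacobiToRound_roundToJacobi (v : RoundSpace F n) :
    jacobiToRound F n (roundToJacobi F n v) = v := by
  have : LinearMap.eqLocus (jacobiToRound F n ∘ₗ roundToJacobi F n) LinearMap.id = ⊤ := by
    refine relatorSpace_induction F fun D => ?_
    rw [LinearMap.mem_eqLocus, LinearMap.comp_apply]
    refine (congrArg _ (roundToJacobi_toSpace F D)).trans ((relatorLift_single F _ _).trans ?_)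
    induction D using Quotient.inductionOn with
    | h D =>
      change resolved F n _ D.toLabelledJacobi.pairing (canonicalDiag (2 * n) 0) = _
      have hD : IsRound D.toLabelledJacobi.pairing
          ((List.ofFn Sum.inl : List (HalfEdge (2 * n) 0)) : Cycle (HalfEdge (2 * n) 0)) D
          Sum.inl := ⟨Sum.inl_injective, fun _ => rfl, rfl⟩
      exact hD.roundClass_eq F
  exact LinearMap.mem_eqLocus.1 (this ▸ Submodule.mem_top)

theorem roundToJacobi_bijective (n : ℕ) : Function.Bijective (roundToJacobi F n) :=
  ⟨Function.LeftInverse.injective (jacobiToRound_roundToJacobi F), roundToJacobi_surjective F n⟩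

end

/-! ### Closing horizontal chord diagrams -/

section

variable {κ : Type} {N n : ℕ}

/-- The pairing of the two ends of each of a set of chords. -/
def endPairing (κ : Type) : Pairing (κ × Bool) where
  mate e := (e.1, !e.2)
  mate_mate := by simp
  mate_ne := by simp [Prod.ext_iff]

theorem place_position_symm_strictMono (D : HorizontalDiagram N n) :
    StrictMono fun i => D.place (D.position.symm i) := by
  have h : ∀ i, D.place (D.position.symm i) = D.places.orderIsoOfFin D.card_places i := by
    intro i
    obtain ⟨e, rfl⟩ := D.position.surjective i
    rw [Equiv.symm_apply_apply]
    simp [HorizontalDiagram.position]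
    rfl
  intro i j hij
  simp only [h]
  exact (D.places.orderIsoOfFin D.card_places).strictMono hij

theorem exists_isRound_close (D : HorizontalDiagram N n) : ∃ B : BasedRound n,
    D.close = B.toRound ∧
      IsRound (endPairing (Fin n))
        ((List.ofFn D.position.symm : List (Fin n × Bool)) : Cycle (Fin n × Bool)) B
        D.position.symm := by
  refine ⟨_, rfl, D.position.symm.injective, fun i => ?_, rfl⟩
  simp only [Equiv.trans_apply, Equiv.symm_apply_apply]
  rfl

/-- The end of a labelled chord on a strand, if there is one. -/
def strandEnds (i : Fin N) (t : κ × Fin N × Fin N) : List (κ × Bool) :=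
  if t.2.1 = i then [(t.1, false)] else if t.2.2 = i then [(t.1, true)] else []

/-- The ends of the labelled chords in the order in which they are met along the closed-up
strands. -/
def closeList (l : List (κ × Fin N × Fin N)) : List (κ × Bool) :=
  (List.finRange N).flatMap fun i => l.flatMap (strandEnds i)

theorem mem_strandEnds {i : Fin N} {t : κ × Fin N × Fin N} {e : κ × Bool}
    (h : e ∈ strandEnds i t) : e.1 = t.1 ∧ (bif e.2 then t.2.2 else t.2.1) = i := by
  unfold strandEnds at h
  split_ifs at h <;> simp_all

/-- Both lists enumerate all ends in strictly increasing order of their places, so they coincide. -/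
theorem closeList_eq (D : HorizontalDiagram N n) :
    closeList (List.ofFn fun k : Fin n => (k, (D.get k).1.1, (D.get k).1.2)) =
      List.ofFn D.position.symm := by
  have hpl : ∀ i k e, e ∈ strandEnds i (k, (D.get k).1.1, (D.get k).1.2) →
      D.place e = toLex (i, k) := by
    rintro i k ⟨k', s⟩ he
    obtain ⟨h1, h2⟩ := mem_strandEnds he
    obtain rfl : k' = k := h1
    exact congrArg (fun i => toLex (i, k')) h2
  have hp : List.Pairwise (fun a b => D.place a < D.place b)
      (closeList (List.ofFn fun k : Fin n => (k, (D.get k).1.1, (D.get k).1.2))) := by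
    rw [closeList, List.pairwise_flatMap]
    constructor
    · intro i _
      rw [List.pairwise_flatMap]
      constructor
      · intro t _
        unfold strandEnds
        split_ifs <;> simp
      · rw [List.pairwise_ofFn]
        intro k l hkl x hx y hy
        rw [hpl _ _ _ hx, hpl _ _ _ hy, Prod.Lex.toLex_lt_toLex]
        exact Or.inr ⟨rfl, hkl⟩
    · refine (List.pairwise_lt_finRange N).imp ?_
      intro i j hij x hx y hy
      obtain ⟨t, ht, hx⟩ := List.mem_flatMap.1 hx
      obtain ⟨u, hu, hy⟩ := List.mem_flatMap.1 hy
      obtain ⟨k, rfl⟩ := List.mem_ofFn.1 ht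
      obtain ⟨l, rfl⟩ := List.mem_ofFn.1 hu
      rw [hpl _ _ _ hx, hpl _ _ _ hy, Prod.Lex.toLex_lt_toLex]
      exact Or.inl hij
  have hp2 : List.Pairwise (fun a b => D.place a < D.place b) (List.ofFn D.position.symm) := by
    rw [List.pairwise_ofFn]
    exact fun i j hij => place_position_symm_strictMono D hij
  refine List.Perm.eq_of_pairwise (fun a b _ _ h1 h2 => absurd h1 h2.not_gt) hp hp2 ?_
  rw [List.perm_ext_iff_of_nodup (hp.imp fun h => by rintro rfl; exact lt_irrefl _ h)
    (hp2.imp fun h => by rintro rfl; exact lt_irrefl _ h)]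
  intro e
  have h2 : e ∈ List.ofFn D.position.symm :=
    List.mem_ofFn.2 ⟨D.position e, D.position.symm_apply_apply e⟩
  refine ⟨fun _ => h2, fun _ => ?_⟩
  obtain ⟨k, s⟩ := e
  rw [closeList, List.mem_flatMap]
  refine ⟨bif s then (D.get k).1.2 else (D.get k).1.1, List.mem_finRange _, ?_⟩
  rw [List.mem_flatMap]
  refine ⟨_, List.mem_ofFn.2 ⟨k, rfl⟩, ?_⟩
  have := (D.get k).2.ne
  cases s <;> simp [strandEnds, this]

/-- A labelled chord whose ends are listed in one of the two orders. -/
def IsLabelled (t : κ × Fin N × Fin N) (c : Chord N) : Prop :=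
  ∃ h : t.2.1 ≠ t.2.2, c = Chord.between t.2.1 t.2.2 h

theorem exists_isRound_closeList {l : List (κ × Fin N × Fin N)} {D : HorizontalDiagram N n}
    (h : List.Forall₂ IsLabelled l D.toList) (nd : (l.map Prod.fst).Nodup) :
    ∃ (B : BasedRound n) (g : Fin (2 * n) → κ × Bool), D.close = B.toRound ∧
      IsRound (endPairing κ) (closeList l : Cycle (κ × Bool)) B g := by
  have hl : l.length = n := by rw [h.length_eq, D.toList_length]
  obtain ⟨t, rfl⟩ := exists_ofFn_eq hl
  have ht : ∀ k : Fin n, IsLabelled (t k) (D.get k) := by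
    intro k
    have := h.get (i := k) (by simp) (by simp)
    simpa [List.Vector.get_eq_get_toList] using this
  rw [List.map_ofFn, List.nodup_ofFn] at nd
  let f : PairingEmb (endPairing (Fin n)) (endPairing κ) :=
    -- A stored chord has its end `false` on the smaller strand; a labelled chord listing the larger
    -- strand first has its ends interchanged.
    { toFun := fun e => ((t e.1).1, xor e.2 (decide ((t e.1).2.2 < (t e.1).2.1)))
      inj := by
        rintro ⟨k, s⟩ ⟨k', s'⟩ he
        simp only [Prod.mk.injEq] at he
        obtain rfl := nd he.1
        simpa using he.2
      map_mate := by
        rintro ⟨k, s⟩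
        simp [endPairing]
        rfl }
  have hc : ∀ i k, strandEnds i (t k) =
      (strandEnds i (k, (D.get k).1.1, (D.get k).1.2)).map f.toFun := by
    intro i k
    obtain ⟨hne, hk⟩ := ht k
    rw [hk]
    rcases hne.lt_or_gt with hlt | hlt
    · simp only [strandEnds, Chord.between, min_eq_left hlt.le, max_eq_right hlt.le]
      split_ifs <;> simp [f, hlt.not_gt]
    · simp only [strandEnds, Chord.between, min_eq_right hlt.le, max_eq_left hlt.le]
      split_ifs with h1 h2
      · exact absurd (h1.trans h2.symm) hne
      all_goals simp [f, hlt]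
  have hmap : closeList (List.ofFn t) = (List.ofFn D.position.symm).map f.toFun := by
    rw [← closeList_eq, closeList, closeList, List.map_flatMap]
    congr 1
    funext i
    rw [List.map_flatMap, List.ofFn_eq_map, List.ofFn_eq_map, List.flatMap_map, List.flatMap_map]
    congr 1
    funext k
    exact hc i k
  obtain ⟨B, hB, hr⟩ := exists_isRound_close D
  refine ⟨B, f.toFun ∘ D.position.symm, hB, ?_⟩
  have := hr.map f
  rwa [Cycle.map_coe, ← hmap] at this

theorem IsRound.valid {K : Type} {σ : Pairing K} {L : List K} {B : BasedRound n}
    {g : Fin (2 * n) → K} (h : IsRound σ (L : Cycle K) B g) : (dg L 0).Valid σ n := by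
  have p : (List.ofFn g).Perm L := (Cycle.coe_eq_coe.1 h.eq).symm.perm
  refine Diag.Valid.perm (L := List.ofFn g) ⟨?_, ?_, by simp, by simp, by simp⟩ p
  · simpa using List.nodup_ofFn.2 h.inj
  · intro k hk
    simp only [mem_supp_dg, Multiset.notMem_zero, false_and, exists_false, or_false,
      List.mem_ofFn] at hk ⊢
    obtain ⟨i, rfl⟩ := hk
    exact ⟨B.mate i, h.map_mate i⟩

theorem exists_labelling (u : List (Chord N)) (s : ℕ) : ∃ u' : List (ℕ × Fin N × Fin N),
    List.Forall₂ IsLabelled u' u ∧ u'.map Prod.fst = List.range' s u.length := by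
  induction u generalizing s with
  | nil => exact ⟨[], List.Forall₂.nil, rfl⟩
  | cons c u ih =>
    obtain ⟨u', h1, h2⟩ := ih (s + 1)
    refine ⟨(s, c.1.1, c.1.2) :: u', List.Forall₂.cons ⟨c.2.ne, ?_⟩ h1, ?_⟩
    · exact Subtype.ext (Prod.ext (min_eq_left c.2.le).symm (max_eq_right c.2.le).symm)
    · simp [h2, List.range'_succ]

/-- The same chord may occur several times in a word, so occurrences need distinct names. The two
middle chords get `0` and `1`, the others labels from `2` on, in either order of the middle chords.
-/
theorem exists_labelling_two (u v : List (Chord N)) : ∃ u' v' : List (ℕ × Fin N × Fin N),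
    List.Forall₂ IsLabelled u' u ∧ List.Forall₂ IsLabelled v' v ∧
      ∀ a b : Fin N × Fin N, ((u' ++ [(0, a), (1, b)] ++ v').map Prod.fst).Nodup ∧
        ((u' ++ [(1, a), (0, b)] ++ v').map Prod.fst).Nodup := by
  obtain ⟨u', h1, h2⟩ := exists_labelling u 2
  obtain ⟨v', h3, h4⟩ := exists_labelling v (2 + u.length)
  refine ⟨u', v', h1, h3, fun a b => ?_⟩
  simp only [List.map_append, List.map_cons, List.map_nil, h2, h4]
  have hu := List.nodup_range' (s := 2) (n := u.length)
  have hv := List.nodup_range' (s := 2 + u.length) (n := v.length)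
  constructor <;>
  · simp only [List.nodup_append, List.nodup_cons, List.mem_append, List.mem_cons,
      List.mem_range'_1, hu, hv]
    simp
    exact ⟨fun _ _ _ => by omega, fun _ _ _ _ _ => by omega⟩

theorem forall₂_word {u v : List (Chord N)} {u' v' : List (κ × Fin N × Fin N)}
    (hu : List.Forall₂ IsLabelled u' u) (hv : List.Forall₂ IsLabelled v' v)
    {t t' : κ × Fin N × Fin N} {c c' : Chord N} (h : IsLabelled t c) (h' : IsLabelled t' c') :
    List.Forall₂ IsLabelled (u' ++ [t, t'] ++ v') (u ++ [c, c'] ++ v) :=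
  List.rel_append (List.rel_append hu (List.Forall₂.cons h (List.Forall₂.cons h'
    List.Forall₂.nil))) hv

variable (F : Type*) [Field F]

theorem close_toSpace_eq {l : List (κ × Fin N × Fin N)} {D : HorizontalDiagram N n}
    (h : List.Forall₂ IsLabelled l D.toList) (nd : (l.map Prod.fst).Nodup) :
    D.close.toSpace F = roundClass F n (endPairing κ) (closeList l : Cycle (κ × Bool)) ∧
      (dg (closeList l) 0).Valid (endPairing κ) n := by
  obtain ⟨B, g, h1, h2⟩ := exists_isRound_closeList h nd
  exact ⟨by rw [h1, h2.roundClass_eq F], h2.valid⟩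

/-- No strand carries ends of both chords, so interchanging them leaves the list of ends along the
strands unchanged. -/
theorem twoTerm_close (n : ℕ) {r : HorizontalDiagram N n →₀ F} (hr : r ∈ twoTermRelators F N n) :
    Finsupp.linearCombination F (fun D : HorizontalDiagram N n => D.close.toSpace F) r = 0 := by
  obtain ⟨u, v, i, j, k, l, hij, hkl, A, B, hik, hil, hjk, hjl, hA, hB, rfl⟩ := hr
  simp only [map_sub, Finsupp.linearCombination_single, one_smul]
  obtain ⟨u', v', hu, hv, nd⟩ := exists_labelling_two u v
  rw [(close_toSpace_eq F (hA ▸ forall₂_word hu hv (t := (0, i, j)) (t' := (1, k, l))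
      ⟨hij, rfl⟩ ⟨hkl, rfl⟩) (nd _ _).1).1,
    (close_toSpace_eq F (hB ▸ forall₂_word hu hv (t := (1, k, l)) (t' := (0, i, j))
      ⟨hkl, rfl⟩ ⟨hij, rfl⟩) (nd _ _).2).1, sub_eq_zero]
  congr 2
  simp only [closeList, List.flatMap_append, List.flatMap_cons, List.flatMap_nil]
  congr 1
  funext m
  congr 2
  simp only [strandEnds]
  split_ifs <;> simp_all

theorem Chord.between_comm {i j : Fin N} (h : i ≠ j) :
    Chord.between i j h = Chord.between j i h.symm :=
  Subtype.ext (Prod.ext (min_comm _ _) (max_comm _ _))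

/-- Label `1` is the fixed chord `t_{ij}` and label `0` the moving one, whose end `true` stays on
strand `k`. Its other end lies on strand `i` or `j`, just before or after the end of chord `1`
there: this is the round 4T relation. The assumption `i < j` says which end of chord `1` is met
first. -/
theorem fourTerm_close_of_lt {u v : List (Chord N)} {i j k : Fin N} (hlt : i < j) (hij : i ≠ j)
    (hik : i ≠ k) (hjk : j ≠ k) {A B C D : HorizontalDiagram N n}
    (hA : A.toList = u ++ [Chord.between i k hik, Chord.between i j hij] ++ v)
    (hB : B.toList = u ++ [Chord.between j k hjk, Chord.between i j hij] ++ v)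
    (hC : C.toList = u ++ [Chord.between i j hij, Chord.between i k hik] ++ v)
    (hD : D.toList = u ++ [Chord.between i j hij, Chord.between j k hjk] ++ v) :
    A.close.toSpace F + B.close.toSpace F - (C.close.toSpace F + D.close.toSpace F) = 0 := by
  obtain ⟨u', v', hu, hv, nd⟩ := exists_labelling_two u v
  obtain ⟨eA, vA⟩ := close_toSpace_eq F (hA ▸ forall₂_word hu hv (t := (0, i, k))
    (t' := (1, i, j)) ⟨hik, rfl⟩ ⟨hij, rfl⟩) (nd _ _).1
  obtain ⟨eB, -⟩ := close_toSpace_eq F (hB ▸ forall₂_word hu hv (t := (0, j, k))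
    (t' := (1, i, j)) ⟨hjk, rfl⟩ ⟨hij, rfl⟩) (nd _ _).1
  obtain ⟨eC, -⟩ := close_toSpace_eq F (hC ▸ forall₂_word hu hv (t := (1, i, j))
    (t' := (0, i, k)) ⟨hij, rfl⟩ ⟨hik, rfl⟩) (nd _ _).2
  obtain ⟨eD, -⟩ := close_toSpace_eq F (hD ▸ forall₂_word hu hv (t := (1, i, j))
    (t' := (0, j, k)) ⟨hij, rfl⟩ ⟨hjk, rfl⟩) (nd _ _).2
  obtain ⟨R₁, R₂, R₃, hR⟩ : ∃ R₁ R₂ R₃, List.finRange N = R₁ ++ i :: (R₂ ++ j :: R₃) := by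
    obtain ⟨P, Q, R, h, -⟩ := list_split_two (W := List.finRange N) (i := i) (j := j) hlt
      (by simp)
    exact ⟨P, Q, R, by simpa using h⟩
  have ndR : (R₁ ++ i :: (R₂ ++ j :: R₃)).Nodup := hR ▸ List.nodup_finRange N
  have hmem : ∀ m, m ∈ R₁ ∨ m ∈ R₂ ∨ m ∈ R₃ → i ≠ m ∧ j ≠ m := by
    intro m hm
    rw [List.nodup_append, List.nodup_cons, List.nodup_append, List.nodup_cons] at ndR
    obtain ⟨-, ⟨h1, -, ⟨h2, -⟩, h3⟩, h4⟩ := ndR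
    simp only [List.mem_append, List.mem_cons, not_or] at h1 h4
    rcases hm with hm | hm | hm
    · exact ⟨(h4 m hm i (Or.inl rfl)).symm, (h4 m hm j (by tauto)).symm⟩
    · exact ⟨fun e => h1.1 (e ▸ hm), (h3 m hm j (by simp)).symm⟩
    · exact ⟨fun e => h1.2.2 (e ▸ hm), fun e => h2 (e ▸ hm)⟩
  -- The ends on a strand other than `i` and `j`, common to the four diagrams.
  let G : Fin N → List (ℕ × Bool) := fun m => u'.flatMap (strandEnds m) ++
    ((if k = m then [(0, true)] else []) ++ v'.flatMap (strandEnds m))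
  have hG : ∀ l : List (ℕ × Fin N × Fin N), (∀ m, i ≠ m → j ≠ m →
      l.flatMap (strandEnds m) = G m) → closeList l = R₁.flatMap G ++
      (l.flatMap (strandEnds i) ++ (R₂.flatMap G ++ (l.flatMap (strandEnds j) ++ R₃.flatMap G))) := by
    intro l hl
    rw [closeList, hR]
    simp only [List.flatMap_append, List.flatMap_cons]
    rw [List.flatMap_congr (f := fun m => l.flatMap (strandEnds m)) (g := G) (l := R₁),
      List.flatMap_congr (f := fun m => l.flatMap (strandEnds m)) (g := G) (l := R₂),
      List.flatMap_congr (f := fun m => l.flatMap (strandEnds m)) (g := G) (l := R₃)]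
    all_goals
      intro m hm
      exact hl m (hmem m (by tauto)).1 (hmem m (by tauto)).2
  rw [hG] at eA eB eC eD vA
  rotate_left
  all_goals try
    intro m h1 h2
    simp only [List.flatMap_append, List.flatMap_cons, List.flatMap_nil, strandEnds, h1, h2,
      if_false, G]
    simp
  simp only [List.flatMap_append, List.flatMap_cons, strandEnds, hij, hij.symm, hik.symm,
    hjk.symm, if_true, if_false, List.nil_append, List.append_assoc, List.cons_append] at eA eB eC eD vA
  have m1 : (endPairing ℕ).mate (1, false) = (1, true) := rfl
  have key := roundClass_fourT F (σ := endPairing ℕ) (y := (1, false)) (b := (0, false))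
    (P := R₁.flatMap G ++ u'.flatMap (strandEnds i))
    (Q := v'.flatMap (strandEnds i) ++ (R₂.flatMap G ++ u'.flatMap (strandEnds j)))
    (R := v'.flatMap (strandEnds j) ++ R₃.flatMap G) (n := n)
  simp only [m1, List.append_assoc] at key
  have key' := key vA (by simp [endPairing])
  rw [eA, eB, eC, eD, ← key']
  abel

theorem fourTerm_close (n : ℕ) {r : HorizontalDiagram N n →₀ F}
    (hr : r ∈ horizontalFourTermRelators F N n) :
    Finsupp.linearCombination F (fun D : HorizontalDiagram N n => D.close.toSpace F) r = 0 := by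
  obtain ⟨u, v, i, j, k, hij, hik, hjk, A, B, C, D, hA, hB, hC, hD, rfl⟩ := hr
  simp only [map_sub, map_add, Finsupp.linearCombination_single, one_smul]
  rcases hij.lt_or_gt with hlt | hlt
  · exact fourTerm_close_of_lt F hlt hij hik hjk hA hB hC hD
  · rw [Chord.between_comm hij] at hA hB hC hD
    have := fourTerm_close_of_lt F hlt hij.symm hjk hik hB hA hD hC
    rw [← this]
    abel

/-- The closing map from horizontal chord diagrams to round chord diagrams. -/
noncomputable def closeMap (N n : ℕ) : HorizontalSpace F N n →ₗ[F] RoundSpace F n :=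
  relatorLift F _ (fun D : HorizontalDiagram N n => D.close.toSpace F) fun _ hr =>
    hr.elim (twoTerm_close F n) (fourTerm_close F n)

theorem closeMap_toSpace (D : HorizontalDiagram N n) :
    closeMap F N n (D.toSpace F) = D.close.toSpace F :=
  relatorLift_single F _ D

end

/-! ### Round chord diagrams as closures, and dual maps -/

section

variable {N n : ℕ}

/-- The involution `mate` exchanges first and second ends of chords. -/
theorem BasedRound.card_first (B : BasedRound n) :
    (Finset.univ.filter fun p => p < B.mate p).card = n := by
  have h1 : (Finset.univ.filter fun p => p < B.mate p).card =
      (Finset.univ.filter fun p => ¬ p < B.mate p).card := by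
    refine Finset.card_bij (fun p _ => B.mate p) ?_ (fun _ _ _ _ h => B.mate.injective h) ?_
    · intro p hp
      simp only [Finset.mem_filter, Finset.mem_univ, true_and, B.mate_mate] at hp ⊢
      exact hp.not_gt
    · intro p hp
      simp only [Finset.mem_filter, Finset.mem_univ, true_and] at hp
      refine ⟨B.mate p, ?_, B.mate_mate p⟩
      simp only [Finset.mem_filter, Finset.mem_univ, true_and, B.mate_mate]
      exact lt_of_le_of_ne (not_lt.1 hp) (B.mate_ne p)
  have h2 := Finset.card_filter_add_card_filter_not (s := (Finset.univ : Finset (Fin (2 * n))))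
    fun p => p < B.mate p
  rw [Finset.card_univ, Fintype.card_fin] at h2
  omega

/-- The number of chords whose second end is met up to a given point. -/
def BasedRound.level (B : BasedRound n) (p : Fin (2 * n)) : ℕ :=
  (Finset.univ.filter fun q => B.mate q < q ∧ q ≤ p).card

theorem BasedRound.level_le (B : BasedRound n) (p : Fin (2 * n)) : B.level p ≤ n := by
  have h : (Finset.univ.filter fun p => B.mate p < p).card ≤ n := by
    refine (Finset.card_le_card_of_injOn B.mate ?_ B.mate.injective.injOn).trans B.card_first.le
    intro p hp
    simpa [B.mate_mate] using hp
  refine (Finset.card_le_card ?_).trans h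
  intro q hq
  simp only [Finset.mem_filter, Finset.mem_univ, true_and] at hq ⊢
  exact hq.1

theorem BasedRound.level_mono (B : BasedRound n) {p q : Fin (2 * n)} (h : p ≤ q) :
    B.level p ≤ B.level q := by
  refine Finset.card_le_card fun r hr => ?_
  simp only [Finset.mem_filter, Finset.mem_univ, true_and] at hr ⊢
  exact ⟨hr.1, hr.2.trans h⟩

theorem BasedRound.level_lt (B : BasedRound n) {p q : Fin (2 * n)} (h : p < q)
    (hq : B.mate q < q) : B.level p < B.level q := by
  refine Finset.card_lt_card ?_
  rw [Finset.ssubset_iff_of_subset]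
  · exact ⟨q, by simp [hq], by simp [h]⟩
  · intro r hr
    simp only [Finset.mem_filter, Finset.mem_univ, true_and] at hr ⊢
    exact ⟨hr.1, hr.2.trans h.le⟩

/-- A point is put on the strand numbered by its level, and chords get heights in the order of their
first ends. The level counts the point itself, so each second end starts a new strand and is
followed there only by first ends of later chords. The two ends of a chord thus lie on different
strands, and the traveller meets all ends in the original order. Levels run from `0` to at most `n`,
whence `n < N`. -/
theorem exists_close_eq (hN : n < N) (B : BasedRound n) :
    ∃ D : HorizontalDiagram N n, D.close = B.toRound := by
  let e := (Finset.univ.filter fun p => p < B.mate p).orderEmbOfFin B.card_first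
  have hef : ∀ k, e k < B.mate (e k) := by
    intro k
    exact (Finset.mem_filter.1 (Finset.orderEmbOfFin_mem _ B.card_first k)).2
  let s : Fin (2 * n) → Fin N := fun p => ⟨B.level p, (B.level_le p).trans_lt hN⟩
  have hs : ∀ k, s (e k) < s (B.mate (e k)) := fun k =>
    B.level_lt (hef k) (by rw [B.mate_mate]; exact hef k)
  let D : HorizontalDiagram N n := List.Vector.ofFn fun k => ⟨(s (e k), s (B.mate (e k))), hs k⟩
  have hD : ∀ k, (D.get k).1 = (s (e k), s (B.mate (e k))) := by
    intro k
    simp [D]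
  let ψ : Fin n × Bool → Fin (2 * n) := fun x => bif x.2 then B.mate (e x.1) else e x.1
  have hplace : ∀ x, D.place x = toLex (s (ψ x), x.1) := by
    rintro ⟨k, b⟩
    cases b <;> simp [HorizontalDiagram.place, hD, ψ]
  have hψi : Function.Injective ψ := by
    rintro ⟨k, b⟩ ⟨l, c⟩ h
    have hk := hef k
    have hl := hef l
    cases b <;> cases c <;> simp only [ψ, cond_true, cond_false] at h
    · rw [e.injective h]
    · rw [h, B.mate_mate] at hk
      exact absurd hk hl.not_gt
    · rw [← h, B.mate_mate] at hl
      exact absurd hl hk.not_gt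
    · rw [e.injective (B.mate.injective h)]
  have hψ : Function.Bijective ψ := by
    rw [Fintype.bijective_iff_injective_and_card]
    exact ⟨hψi, by simp [mul_comm]⟩
  have hle : ∀ x, e x.1 ≤ ψ x := by
    rintro ⟨k, b⟩
    cases b
    · exact le_rfl
    · exact (hef k).le
  have hmono : ∀ x y, ψ x < ψ y → D.place x < D.place y := by
    intro x y hxy
    rw [hplace, hplace, Prod.Lex.toLex_lt_toLex]
    -- On equal levels the later point cannot be a second end, as this would raise the level; so it
    -- is a first end, and heights compare because a chord's first end precedes both of its ends
    -- weakly.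
    rcases (B.level_mono hxy.le).lt_or_eq with h | h
    · exact Or.inl h
    · refine Or.inr ⟨Fin.ext h, ?_⟩
      obtain ⟨k, b⟩ := y
      cases b
      · exact e.lt_iff_lt.1 ((hle x).trans_lt hxy)
      · refine absurd h (B.level_lt hxy ?_).ne
        simp only [ψ, cond_true, B.mate_mate]
        exact hef k
  set ψ' := Equiv.ofBijective ψ hψ with hψ'
  have hsymm : ∀ i, ψ (ψ'.symm i) = i := ψ'.apply_symm_apply
  have hmono' : StrictMono fun i => D.place (ψ'.symm i) := fun i j hij =>
    hmono _ _ (by rwa [hsymm, hsymm])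
  have heq : D.position.symm = ψ'.symm := by
    -- Two increasing enumerations of the same set of places are equal.
    have h1 := ((place_position_symm_strictMono D).range_inj hmono').1 (by
      have a := D.position.symm.surjective.range_comp D.place
      have b := ψ'.symm.surjective.range_comp D.place
      exact a.trans b.symm)
    ext1 i
    exact D.place_injective (congrFun h1 i)
  obtain ⟨B', hB', hr⟩ := exists_isRound_close D
  refine ⟨D, hB'.trans (hr.toRound_eq (g' := ψ'.symm)
    ⟨ψ'.symm.injective, fun i => ?_, by rw [heq]⟩)⟩
  obtain ⟨x, rfl⟩ := ψ'.surjective i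
  rw [Equiv.symm_apply_apply, Equiv.symm_apply_eq]
  obtain ⟨k, b⟩ := x
  cases b <;> simp [ψ', ψ, endPairing, B.mate_mate]

variable (F : Type*) [Field F]

theorem closeMap_surjective (hN : n < N) : Function.Surjective (closeMap F N n) := by
  rw [← LinearMap.range_eq_top]
  refine relatorSpace_induction F fun D => ?_
  induction D using Quotient.inductionOn with
  | h B =>
    obtain ⟨D, hD⟩ := exists_close_eq hN B
    exact ⟨D.toSpace F, (closeMap_toSpace F D).trans (congrArg (RoundDiagram.toSpace F) hD)⟩

/-! ### Dual maps -/

variable {F}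

theorem gradedDualMap_injective {A B : ℕ → Type*} [∀ n, AddCommMonoid (A n)]
    [∀ n, Module F (A n)] [∀ n, AddCommMonoid (B n)] [∀ n, Module F (B n)]
    {f : ∀ n, A n →ₗ[F] B n} (h : ∀ n, Function.Surjective (f n)) :
    Function.Injective (gradedDualMap f) :=
  (DirectSum.lmap_injective _).2 fun n => LinearMap.dualMap_injective_of_surjective (h n)

theorem gradedDualMap_bijective {A B : ℕ → Type*} [∀ n, AddCommGroup (A n)]
    [∀ n, Module F (A n)] [∀ n, AddCommGroup (B n)] [∀ n, Module F (B n)]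
    {f : ∀ n, A n →ₗ[F] B n} (h : ∀ n, Function.Bijective (f n)) :
    Function.Bijective (gradedDualMap f) :=
  ⟨gradedDualMap_injective fun n => (h n).2, (DirectSum.lmap_surjective _).2 fun n =>
    LinearMap.dualMap_surjective_of_injective (h n).1⟩

end

end ChordDiagrams

open ChordDiagrams in
theorem mainTheorem6 (F : Type*) [Field F] :
    ∃ (cl : ∀ (N : ℕ+) (n : ℕ), HorizontalSpace F N n →ₗ[F] RoundSpace F n)
      (inc : ∀ n : ℕ, RoundSpace F n →ₗ[F] JacobiSpace F n),
      (∀ (N : ℕ+) (n : ℕ) (D : HorizontalDiagram N n),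
        cl N n (D.toSpace F) = D.close.toSpace F) ∧
      (∀ (n : ℕ) (D : RoundDiagram n), inc n (D.toSpace F) = D.toJacobi.toSpace F) ∧
      (∀ n, Function.Bijective (inc n)) ∧
      Function.Bijective (gradedDualMap inc : JacobiWeights F →ₗ[F] RoundWeights F) ∧
      Function.Injective
        (gradedDualMap (fun n => DirectSum.toModule F ℕ+ (RoundSpace F n) fun N => cl N n) :
          RoundWeights F →ₗ[F] HorizontalTotalWeights F) ∧
      (∀ (N : ℕ+) (n : ℕ), n < N → Function.Injective (cl N n).dualMap) := by
  refine ⟨fun N n => closeMap F N n, roundToJacobi F, fun N n D => closeMap_toSpace F D,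
    fun n D => roundToJacobi_toSpace F D, roundToJacobi_bijective F,
    gradedDualMap_bijective (A := RoundSpace F) (B := JacobiSpace F) (roundToJacobi_bijective F),
    gradedDualMap_injective fun n v => ?_,
    fun N n h => LinearMap.dualMap_injective_of_surjective (closeMap_surjective F h)⟩
  -- With any number of strands allowed, `n + 1` strands suffice for surjectivity in degree `n`.
  obtain ⟨w, hw⟩ := closeMap_surjective F (n := n) (N := ((n.succPNat : ℕ+) : ℕ)) (by simp) v
  exact ⟨DirectSum.lof F ℕ+ (fun N : ℕ+ => HorizontalSpace F N n) n.succPNat w, by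
    rw [DirectSum.toModule_lof, hw]⟩
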